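/- Let $\Bbbk$ be a field and let $\ell,k\ge 0$ be integers. A Stendhal diagram with $\ell$ red and $k$ black strands is a collection of $\ell$ red and $k$ black smooth curves in $\mathbb{R}\times[0,1]$, running monotonically from $y=1$ to $y=0$, without tangencies, triple points or intersections of two red curves, where black strands may carry dots away from crossings; diagrams are taken up to isotopy preserving these conditions. The product $ab$ is $a$ stacked on top of $b$, and is $0$ if the colours at the bottom of $a$ and the top of $b$ do not match. A generic horizontal slice is recorded by the weakly increasing function $\kappa\colon[1,\ell]\to[0,k]$ for which $\kappa(h)$ is the number of black strands to the left of the $h$th red strand. Let $e_\kappa$ be the diagram of vertical strands with slice $\kappa$, and let - $y_{i,\kappa}$ ($1\le i\le k$) be $e_\kappa$ with a dot on the $i$th black strand; - $\psi_{i,\kappa}$ ($1\le i<k$, $i\notin\operatorname{im}\kappa$) be $e_\kappa$ with the $i$th and $(i+1)$st black strands (which have no red strand between them) crossed once; - $\iota^+_{i,\kappa}$ ($1\le i\le k$, $i-1\in\operatorname{im}\kappa$) be the diagram with bottom $\kappa$ in which the $i$th black strand crosses the red strand next to it on its left; its top is $\kappa_i^+$, which is $\kappa$ with its value at the last place where it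 equals $i-1$ increased to $i$; - $\iota^-_{i,\kappa}$ ($1\le i\le k$, $i\in\operatorname{im}\kappa$) be the diagram with bottom $\kappa$ in which the $i$th black strand crosses the red strand next to it on its right; its top is $\kappa_i^-$, which is $\kappa$ with its value at the first place where it equals $i$ decreased to $i-1$. Let $T^\ell_{\ell-2k}$ be the $\Bbbk$-algebra spanned by these diagrams modulo the following local relations. Write $\psi_j$ for the crossing of the adjacent $j$th and $(j+1)$st black strands, $y_j$ for a dot on the $j$th black strand, $\iota_j^{+}$ and $\iota_j^-$ for a crossing of the $j$th black strand with the adjacent red strand on its left, respectively right. Each relation is imposed on neighbouring strands with the indicated colours at the bottom (from left to right), numbering only the black strands involved, and with arbitrary strands to the left and right: - (black, black): $y_1\psi_1=\psi_1y_2-1$, $\ \psi_1y_1=y_2\psi_1-1$, $\ \psi_1^2=0$; - (black, black, black): $\psi_1\psi_2\psi_1=\psi_2\psi_1\psi_2$; - (black, red, black): $\iota_1^+\psi_1\iota_1^-=\iota_2^-\psi_1\iota_2^+-1$; - (black, black, red): $\iota_1^-\iota_2^-\psi_1=\psi_1\iota_1^-\iota_2^-$; - (black, red): $\iota_1^-y_1=y_1\iota_1^-$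 and $\iota_1^+\iota_1^-=y_1$; - (red, black): $\iota_1^-\iota_1^+=y_1$; - any diagram with a slice in which the leftmost strand is black is $0$. Let $R=\Bbbk[Y_1,\dots,Y_k]$, and for weakly increasing $\kappa\colon[1,\ell]\to[0,k]$ let $I_\kappa\subset R$ be the ideal generated by the complete symmetric polynomials $h_p(Y_1,\dots,Y_{\kappa(q)})$ for $1\le q\le \ell$, $p\ge 0$, $p>q-\kappa(q)-1$, together with $h_p(Y_1,\dots,Y_k)$ for $p\ge 0$, $p>\ell-k$ (where $h_0=1$, and $h_p$ of no variables is $0$ for $p>0$). Then there is a left action (a unital $\Bbbk$-algebra homomorphism to the endomorphisms) of $T^\ell_{\ell-2k}$ on $\bigoplus_\kappa R/I_\kappa$, and exactly one, in which every $e_\kappa$ acts as the projection to the summand $R/I_\kappa$ and in which, for every $f\in R$ representing an element of $R/I_\kappa$, \begin{align*} y_{i,\kappa}(f)&=Y_if\in R/I_\kappa,\\ \psi_{i,\kappa}(f)&=\frac{f-s_i f}{Y_{i+1}-Y_i}\in R/I_\kappa &&(i\notin\operatorname{im}\kappa),\\ \iota^+_{i,\kappa}(f)&=f\in R/I_{\kappa_i^+}&&(i-1\in\operatorname{im}\kappa),\\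 \iota^-_{i,\kappa}(f)&=Y_if\in R/I_{\kappa_i^-}&&(i\in\operatorname{im}\kappa), \end{align*} where $s_i$ exchanges the variables $Y_i$ and $Y_{i+1}$. -/

import Mathlib

namespace Stendhal

noncomputable section

/-! ### Stendhal diagrams

A Stendhal diagram, up to isotopy, is recorded by putting its dots and crossings at distinct heights
and listing them from bottom to top.  A generic horizontal slice is a word in the two colours, and
each dot or crossing is a `Piece` with straight strands to its left and right.  Since isotopies create
neither tangencies nor triple points, two such lists give isotopic diagrams exactly when
they differ by exchanging the heights of neighbouring pieces which share no strand. -/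

/-- The colours of strands. -/
inductive Color
  | red
  | black
  deriving DecidableEq

/-- The dots and crossings which may occur in a Stendhal diagram.
There is no crossing of two red strands. -/
inductive Piece
  /-- a dot on a black strand -/
  | dot
  /-- a crossing of two black strands -/
  | bb
  /-- a crossing, red on the left at the bottom and black on the left at the top -/
  | rb
  /-- a crossing, black on the left at the bottom and red on the left at the top -/
  | br

open Color

/-- The colours at the bottom of a piece, from left to right. -/
def Piece.bot : Piece → List Color
  | .dot => [black]
  | .bb => [black, black]
  | .rb => [red, black]
  | .br => [black, red]

/-- The colours at the top of a piece, from left to right. -/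
def Piece.top : Piece → List Color
  | .dot => [black]
  | .bb => [black, black]
  | .rb => [black, red]
  | .br => [red, black]

/-- Diagrams with at most one dot or crossing: `idem s` consists of vertical strands with the colours
`s`; `layer L p R` is the piece `p` with vertical strands `L` on its left and `R` on its right. -/
inductive Gen
  | idem (s : List Color)
  | layer (L : List Color) (p : Piece) (R : List Color)

/-- The words with `ℓ` red and `k` black letters. -/
def words (ℓ k : ℕ) : Finset (List Color) :=
  (List.replicate ℓ red ++ List.replicate k black).permutations.toFinset

section Algebra

variable (𝕜 : Type*) [Field 𝕜]

/-- `Gen.idem s` as an element of the free algebra. -/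
def E (s : List Color) : FreeAlgebra 𝕜 Gen := FreeAlgebra.ι 𝕜 (Gen.idem s)

/-- `Gen.layer L p R` as an element of the free algebra. -/
def lay (L : List Color) (p : Piece) (R : List Color) : FreeAlgebra 𝕜 Gen :=
  FreeAlgebra.ι 𝕜 (Gen.layer L p R)

/-- The defining relations of the algebra of Stendhal diagrams with `ℓ` red and `k` black strands.
The product `a * b` is `a` stacked on top of `b`.  All local relations are imposed with arbitrary
strands `L` on the left and `R` on the right. -/
inductive Rel (ℓ k : ℕ) : FreeAlgebra 𝕜 Gen → FreeAlgebra 𝕜 Gen → Prop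
  -- stacking: the product is zero unless the colours match; only `ℓ` red and `k` black strands
  | idem_mul_self (s : List Color) : Rel ℓ k (E 𝕜 s * E 𝕜 s) (E 𝕜 s)
  | idem_mul_ne (s t : List Color) (h : s ≠ t) : Rel ℓ k (E 𝕜 s * E 𝕜 t) 0
  | top_mul (L : List Color) (p : Piece) (R : List Color) :
      Rel ℓ k (E 𝕜 (L ++ p.top ++ R) * lay 𝕜 L p R) (lay 𝕜 L p R)
  | mul_bot (L : List Color) (p : Piece) (R : List Color) :
      Rel ℓ k (lay 𝕜 L p R * E 𝕜 (L ++ p.bot ++ R)) (lay 𝕜 L p R)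
  | idem_other (s : List Color) (h : s ∉ words ℓ k) : Rel ℓ k (E 𝕜 s) 0
  | idem_sum : Rel ℓ k (∑ s ∈ words ℓ k, E 𝕜 s) 1
  -- isotopy: the heights of distant pieces may be exchanged
  | interchange (L M R : List Color) (p q : Piece) :
      Rel ℓ k (lay 𝕜 L p (M ++ q.top ++ R) * lay 𝕜 (L ++ p.bot ++ M) q R)
        (lay 𝕜 (L ++ p.top ++ M) q R * lay 𝕜 L p (M ++ q.bot ++ R))
  -- a dot slides through a black crossing
  | dot_left_top (L R : List Color) :
      Rel ℓ k (lay 𝕜 L .dot ([black] ++ R) * lay 𝕜 L .bb R)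
        (lay 𝕜 L .bb R * lay 𝕜 (L ++ [black]) .dot R - E 𝕜 (L ++ [black, black] ++ R))
  | dot_left_bot (L R : List Color) :
      Rel ℓ k (lay 𝕜 L .bb R * lay 𝕜 L .dot ([black] ++ R))
        (lay 𝕜 (L ++ [black]) .dot R * lay 𝕜 L .bb R - E 𝕜 (L ++ [black, black] ++ R))
  -- black bigon and black triple point
  | bigon (L R : List Color) : Rel ℓ k (lay 𝕜 L .bb R * lay 𝕜 L .bb R) 0
  | braid (L R : List Color) :
      Rel ℓ k
        (lay 𝕜 L .bb ([black] ++ R) * lay 𝕜 (L ++ [black]) .bb R * lay 𝕜 L .bb ([black] ++ R))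
        (lay 𝕜 (L ++ [black]) .bb R * lay 𝕜 L .bb ([black] ++ R) * lay 𝕜 (L ++ [black]) .bb R)
  -- a red strand between two crossing black strands
  | red_triple (L R : List Color) :
      Rel ℓ k
        (lay 𝕜 L .rb ([black] ++ R) * lay 𝕜 (L ++ [red]) .bb R * lay 𝕜 L .br ([black] ++ R))
        (lay 𝕜 (L ++ [black]) .br R * lay 𝕜 L .bb ([red] ++ R) * lay 𝕜 (L ++ [black]) .rb R
          - E 𝕜 (L ++ [black, red, black] ++ R))
  -- a red strand passes across a black crossing
  | red_pass (L R : List Color) :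
      Rel ℓ k
        (lay 𝕜 L .br ([black] ++ R) * lay 𝕜 (L ++ [black]) .br R * lay 𝕜 L .bb ([red] ++ R))
        (lay 𝕜 (L ++ [red]) .bb R * lay 𝕜 L .br ([black] ++ R) * lay 𝕜 (L ++ [black]) .br R)
  -- a dot slides through a red/black crossing
  | red_dot (L R : List Color) :
      Rel ℓ k (lay 𝕜 L .br R * lay 𝕜 L .dot ([red] ++ R))
        (lay 𝕜 (L ++ [red]) .dot R * lay 𝕜 L .br R)
  -- red/black bigons
  | cost_left (L R : List Color) :
      Rel ℓ k (lay 𝕜 L .rb R * lay 𝕜 L .br R) (lay 𝕜 L .dot ([red] ++ R))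
  | cost_right (L R : List Color) :
      Rel ℓ k (lay 𝕜 L .br R * lay 𝕜 L .rb R) (lay 𝕜 (L ++ [red]) .dot R)
  -- a diagram with a slice whose leftmost strand is black is zero
  | violating (s : List Color) : Rel ℓ k (E 𝕜 ([black] ++ s)) 0

/-- The algebra `T^ℓ_{ℓ-2k}` of Stendhal diagrams with `ℓ` red and `k` black strands. -/
abbrev T (ℓ k : ℕ) : Type _ := RingQuot (Rel 𝕜 ℓ k)

/-- The class in `T^ℓ_{ℓ-2k}` of a combination of diagrams. -/
abbrev toT (ℓ k : ℕ) : FreeAlgebra 𝕜 Gen →ₐ[𝕜] T 𝕜 ℓ k := RingQuot.mkAlgHom 𝕜 (Rel 𝕜 ℓ k)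

end Algebra

/-! ### Slices as functions -/

/-- Weakly increasing functions `κ : [1,ℓ] → [0,k]`; the red strands are numbered from `0`. -/
abbrev Kappa (ℓ k : ℕ) := Fin ℓ →o Fin (k + 1)

instance (ℓ k : ℕ) : DecidableEq (Kappa ℓ k) := fun a b =>
  decidable_of_iff (∀ h, a h = b h) DFunLike.ext_iff.symm

variable {ℓ k : ℕ}

/-- The red strands with exactly `j` black strands on their left. -/
def reds (κ : Kappa ℓ k) (j : ℕ) : List Color :=
  List.replicate (Finset.univ.filter fun h : Fin ℓ => (κ h : ℕ) = j).card red

/-- The part of the slice `κ` to the left of the black strand number `i` (counted from `0`);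
the whole slice if `i = k`. -/
def pre (κ : Kappa ℓ k) (i : ℕ) : List Color :=
  (List.range i).flatMap (fun j => reds κ j ++ [black]) ++ reds κ i

/-- The part of the slice `κ` to the right of the black strand number `i` (counted from `0`). -/
def post (κ : Kappa ℓ k) (i : ℕ) : List Color :=
  (List.range' (i + 1) (k - (i + 1))).flatMap (fun j => reds κ j ++ [black]) ++ reds κ k

/-- The colours of the slice in which `κ h` black strands are on the left of the red strand `h`. -/
def word (κ : Kappa ℓ k) : List Color := pre κ k

/-- `κ` with its value at the last place where it is `i` increased to `i + 1`. -/
def plus (κ : Kappa ℓ k) (i : Fin k) : Kappa ℓ k where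
  toFun h := if κ h = i.castSucc ∧ ∀ h', h < h' → κ h' ≠ i.castSucc then i.succ else κ h
  monotone' := by
    intro a b hab
    have hk := κ.monotone hab
    rcases hab.eq_or_lt with rfl | hlt
    · exact le_rfl
    · dsimp only
      split_ifs with h1 h2 h2
      · exact le_rfl
      · have h3 := h1.2 b hlt
        rw [h1.1] at hk
        exact Fin.castSucc_lt_iff_succ_le.1 (lt_of_le_of_ne hk (Ne.symm h3))
      · rw [h2.1] at hk
        exact hk.trans (Fin.castSucc_lt_succ).le
      · exact hk

/-- `κ` with its value at the first place where it is `i + 1` decreased to `i`. -/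
def minus (κ : Kappa ℓ k) (i : Fin k) : Kappa ℓ k where
  toFun h := if κ h = i.succ ∧ ∀ h', h' < h → κ h' ≠ i.succ then i.castSucc else κ h
  monotone' := by
    intro a b hab
    have hk := κ.monotone hab
    rcases hab.eq_or_lt with rfl | hlt
    · exact le_rfl
    · dsimp only
      split_ifs with h1 h2 h2
      · exact le_rfl
      · rw [h1.1] at hk
        exact (Fin.castSucc_lt_succ).le.trans hk
      · have h3 := h2.2 a hlt
        rw [h2.1] at hk
        exact Fin.le_castSucc_iff.2 (lt_of_le_of_ne hk h3)
      · exact hk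

/-! ### The named elements

Black strands are numbered from `0`, so the black strand `i : Fin k` is the `(i+1)`st one, and it has
`i` black strands on its left. -/

section Elements

variable (𝕜 : Type*) [Field 𝕜]

/-- `e_κ`: vertical strands. -/
def e (κ : Kappa ℓ k) : T 𝕜 ℓ k := toT 𝕜 ℓ k (E 𝕜 (word κ))

/-- `y_{i,κ}`: a dot on the black strand `i` of `κ`. -/
def y (i : Fin k) (κ : Kappa ℓ k) : T 𝕜 ℓ k :=
  toT 𝕜 ℓ k (lay 𝕜 (pre κ i) .dot (post κ i))

/-- `ψ_{i,κ}`: the crossing of the black strands `i` and `i + 1` of `κ`, when there is no red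
strand between them, that is, when `i + 1` is not a value of `κ`. -/
def psi (i : ℕ) (κ : Kappa ℓ k) : T 𝕜 ℓ k :=
  toT 𝕜 ℓ k (lay 𝕜 (pre κ i) .bb (post κ (i + 1)))

/-- `ι⁺_{i,κ}`: the crossing of the black strand `i` of `κ` with the red strand next to it on its
left, when there is one, that is, when `i` is a value of `κ`. -/
def iotaPlus (i : Fin k) (κ : Kappa ℓ k) : T 𝕜 ℓ k :=
  toT 𝕜 ℓ k (lay 𝕜 (pre κ i).dropLast .rb (post κ i))

/-- `ι⁻_{i,κ}`: the crossing of the black strand `i` of `κ` with the red strand next to it on its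
right, when there is one, that is, when `i + 1` is a value of `κ`. -/
def iotaMinus (i : Fin k) (κ : Kappa ℓ k) : T 𝕜 ℓ k :=
  toT 𝕜 ℓ k (lay 𝕜 (pre κ i) .br (post κ i).tail)

end Elements

/-! ### The representation space -/

section Rep

variable (𝕜 : Type*) [Field 𝕜]

/-- The complete symmetric polynomial `h_p` in the first `j` of the `k` variables. -/
def hFirst (k j p : ℕ) : MvPolynomial (Fin k) 𝕜 :=
  MvPolynomial.rename Subtype.val (MvPolynomial.hsymm {i : Fin k // (i : ℕ) < j} 𝕜 p)

/-- The ideal `I_κ`.  The red strand `q : Fin ℓ` is the `(q+1)`st one. -/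
def I (κ : Kappa ℓ k) : Ideal (MvPolynomial (Fin k) 𝕜) :=
  Ideal.span
    ({f | ∃ (q : Fin ℓ) (p : ℕ), ((q : ℤ) + 1) - (κ q : ℕ) - 1 < p ∧ f = hFirst 𝕜 k (κ q) p} ∪
      {f | ∃ p : ℕ, (ℓ : ℤ) - k < p ∧ f = hFirst 𝕜 k k p})

/-- The sum of the quotients `R / I_κ`. -/
abbrev V (ℓ k : ℕ) : Type _ :=
  DirectSum (Kappa ℓ k) fun κ => MvPolynomial (Fin k) 𝕜 ⧸ I 𝕜 κ

/-- The class of the polynomial `f` in the summand `R / I_κ`. -/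
def cls (κ : Kappa ℓ k) (f : MvPolynomial (Fin k) 𝕜) : V 𝕜 ℓ k :=
  DirectSum.lof 𝕜 (Kappa ℓ k) (fun κ => MvPolynomial (Fin k) 𝕜 ⧸ I 𝕜 κ) κ
    (Ideal.Quotient.mk (I 𝕜 κ) f)

/-- The projection of the sum to the summand `R / I_κ`. -/
def proj (κ : Kappa ℓ k) : Module.End 𝕜 (V 𝕜 ℓ k) :=
  DirectSum.lof 𝕜 (Kappa ℓ k) (fun κ => MvPolynomial (Fin k) 𝕜 ⧸ I 𝕜 κ) κ ∘ₗ
    DirectSum.component 𝕜 (Kappa ℓ k) (fun κ => MvPolynomial (Fin k) 𝕜 ⧸ I 𝕜 κ) κ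

variable {𝕜}

theorem sub_dvd_sub_swap (i j : Fin k) (f : MvPolynomial (Fin k) 𝕜) :
    (MvPolynomial.X j - MvPolynomial.X i : MvPolynomial (Fin k) 𝕜) ∣
      f - MvPolynomial.rename (Equiv.swap i j) f := by
  rw [← Ideal.mem_span_singleton, ← Ideal.Quotient.eq]
  set J := Ideal.span {(MvPolynomial.X j - MvPolynomial.X i : MvPolynomial (Fin k) 𝕜)}
  have hij : Ideal.Quotient.mk J (MvPolynomial.X j) = Ideal.Quotient.mk J (MvPolynomial.X i) :=
    Ideal.Quotient.eq.2 (Ideal.mem_span_singleton_self _)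
  have key : Ideal.Quotient.mkₐ 𝕜 J =
      (Ideal.Quotient.mkₐ 𝕜 J).comp (MvPolynomial.rename (Equiv.swap i j)) := by
    ext m
    simp only [AlgHom.comp_apply, MvPolynomial.rename_X, Ideal.Quotient.mkₐ_eq_mk]
    rcases eq_or_ne m i with rfl | hi
    · rw [Equiv.swap_apply_left, hij]
    · rcases eq_or_ne m j with rfl | hj
      · rw [Equiv.swap_apply_right, hij]
      · rw [Equiv.swap_apply_of_ne_of_ne hi hj]
  exact DFunLike.congr_fun key f

/-- The Demazure operator: the quotient of `f - f(s • Y)` by `Y_j - Y_i`, where `s` exchanges the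
variables `Y_i` and `Y_j`. -/
def demazure (i j : Fin k) (f : MvPolynomial (Fin k) 𝕜) : MvPolynomial (Fin k) 𝕜 :=
  (sub_dvd_sub_swap i j f).choose

theorem sub_mul_demazure (i j : Fin k) (f : MvPolynomial (Fin k) 𝕜) :
    (MvPolynomial.X j - MvPolynomial.X i) * demazure i j f =
      f - MvPolynomial.rename (Equiv.swap i j) f :=
  (sub_dvd_sub_swap i j f).choose_spec.symm

end Rep

end

end Stendhal

namespace Stendhal

noncomputable section

open Color

variable {ℓ k : ℕ}

/-! ### Words and their profiles -/

/-! Before passing to quotients, diagrams act on a sum of copies of $R$, one for each slice: a dot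
multiplies by its variable, a black crossing is a Demazure operator, and of the two red/black
crossings one is the identity and the other multiplies by a variable. The relations, other than the
violating one, become identities of polynomial operators: the nilHecke relations for Demazure
operators, and the fact that these operators are linear over polynomials symmetric in the two
variables (`freeAct_rel`).

The substance is that the ideals $I_\kappa$ are respected (`polyOp_mem`). The generators
$h_p(Y_1,\dots,Y_k)$, $p>\ell-k$, are those of one further red strand at the far right, so all
generators have the same form. A black crossing preserves the ideal because every generator is
symmetric in the two variables concerned. For red crossings the recursion
$h_{p+1}(Y_1,\dots,Y_{j+1})=Y_{j+1}h_p(Y_1,\dots,Y_{j+1})+h_{p+1}(Y_1,\dots,Y_j)$ gives the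
inclusions `profileIdeal_le` and `X_mul_mem_profileIdeal`. If the leftmost strand is black, then
$h_0=1$ is a generator and the summand vanishes.

For uniqueness, a diagram with one dot or crossing either starts at a slice $\kappa$, and is then
one of the named elements, or is zero. Slices are matched with functions $\kappa$ through the
profile of a word. -/

/-- For each red letter of a word, the number of black letters to its left. -/
def profile : List Color → List ℕ
  | [] => []
  | red :: s => 0 :: profile s
  | black :: s => (profile s).map (· + 1)

theorem profile_append (s t : List Color) :
    profile (s ++ t) = profile s ++ (profile t).map (· + s.count black) := by
  induction s with
  | nil => simp [profile]
  | cons c s ih =>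
    cases c
    · simp [profile, ih]
    · simp [profile, ih, Function.comp_def, add_assoc]

theorem length_profile (s : List Color) : (profile s).length = s.count red := by
  induction s with
  | nil => rfl
  | cons c s ih => cases c <;> simp [profile, ih]

theorem profile_le (s : List Color) : ∀ b ∈ profile s, b ≤ s.count black := by
  induction s with
  | nil => simp [profile]
  | cons c s ih => cases c <;> simpa [profile] using ih

theorem pairwise_profile (s : List Color) : (profile s).Pairwise (· ≤ ·) := by
  induction s with
  | nil => simp [profile]
  | cons c s ih =>
    cases c
    · simpa [profile] using ih
    · simpa [profile, List.pairwise_map] using ih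

/-- A profile starts with 0 exactly when the word starts with a red letter. The number of black
letters has to be given as well, since black letters after the last red one leave no trace in the
profile. -/
theorem eq_of_profile_eq {s t : List Color} (h : profile s = profile t)
    (hb : s.count black = t.count black) : s = t := by
  induction s generalizing t with
  | nil =>
    cases t with
    | nil => rfl
    | cons c t => cases c <;> simp [profile] at h hb
  | cons c s ih =>
    cases t with
    | nil => cases c <;> simp [profile] at h hb
    | cons d t =>
      cases c <;> cases d
      · rw [ih (by simpa [profile] using h) (by simpa using hb)]
      · have := congrArg (fun l => l.head?) h
        cases hp : profile t <;> simp [profile, hp] at this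
      · have := congrArg (fun l => l.head?) h
        cases hp : profile s <;> simp [profile, hp] at this
      · rw [ih (List.map_injective_iff.2 (add_left_injective 1) h) (by simpa using hb)]

theorem mem_words_iff {s : List Color} :
    s ∈ words ℓ k ↔ s.count red = ℓ ∧ s.count black = k := by
  rw [words, List.mem_toFinset, List.mem_permutations, List.perm_iff_count]
  constructor
  · intro h
    have h1 := h red
    have h2 := h black
    simp [List.count_replicate] at h1 h2
    exact ⟨h1, h2⟩
  · rintro ⟨h1, h2⟩ c
    cases c <;> simp [List.count_replicate, h1, h2]

/-! ### Words as weakly increasing functions -/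

theorem pre_succ (κ : Kappa ℓ k) (i : ℕ) :
    pre κ (i + 1) = pre κ i ++ [black] ++ reds κ (i + 1) := by
  simp [pre, List.range_succ]

theorem count_black_pre (κ : Kappa ℓ k) (i : ℕ) : (pre κ i).count black = i := by
  induction i with
  | zero => simp [pre, reds, List.count_replicate]
  | succ i ih => simp [pre_succ, ih, reds, List.count_replicate]

theorem count_black_word (κ : Kappa ℓ k) : (word κ).count black = k := count_black_pre κ k

theorem profile_replicate_red (n : ℕ) :
    profile (List.replicate n red) = List.replicate n 0 := by
  induction n with
  | zero => rfl
  | succ n ih => simp [List.replicate_succ, profile, ih]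

theorem count_profile_pre (κ : Kappa ℓ k) (i j : ℕ) :
    (profile (pre κ i)).count j =
      if j ≤ i then (Finset.univ.filter fun h : Fin ℓ => (κ h : ℕ) = j).card else 0 := by
  induction i with
  | zero =>
    simp only [pre, reds, List.range_zero, List.flatMap_nil, List.nil_append,
      profile_replicate_red, List.count_replicate, beq_iff_eq, nonpos_iff_eq_zero]
    rcases eq_or_ne j 0 with rfl | hj
    · simp
    · simp [hj, hj.symm]
  | succ i ih =>
    rw [pre_succ, profile_append, profile_append, List.count_append, List.count_append, ih, reds,
      profile_replicate_red]
    simp only [profile, List.map_nil, List.count_nil, List.map_replicate, List.count_append,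
      count_black_pre, List.count_replicate, List.count_singleton_self, beq_iff_eq, zero_add]
    rcases lt_trichotomy j (i + 1) with hj | rfl | hj
    · simp [hj.ne', Nat.lt_succ_iff.1 hj, hj.le]
    · simp
    · simp [hj.ne, hj.not_ge, show ¬ j ≤ i by omega]

/-- Both lists are weakly increasing, so it suffices to compare multiplicities. -/
theorem profile_word (κ : Kappa ℓ k) : profile (word κ) = List.ofFn fun h => (κ h : ℕ) := by
  refine List.Perm.eq_of_pairwise (le := (· ≤ ·)) (fun a b _ _ => le_antisymm)
    (pairwise_profile _) ?_ (List.perm_iff_count.2 fun j => ?_)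
  · rw [List.pairwise_ofFn]
    exact fun i j hij => κ.monotone hij.le
  · rw [word, count_profile_pre, List.ofFn_eq_map, List.count, List.countP_map,
      List.countP_eq_length_filter]
    split_ifs with hj
    · rw [Finset.card_def, Finset.filter_val, Fin.univ_def, Multiset.filter_coe, Multiset.coe_card]
      rfl
    · rw [eq_comm, List.length_eq_zero_iff, List.filter_eq_nil_iff]
      intro h _ hh
      have := (κ h).is_le
      simp at hh
      omega

theorem word_injective : Function.Injective (word : Kappa ℓ k → List Color) := by
  intro κ κ' h
  have h1 := congrArg profile h
  rw [profile_word, profile_word] at h1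
  ext i
  exact congrFun (List.ofFn_injective h1) i

theorem count_red_word (κ : Kappa ℓ k) : (word κ).count red = ℓ := by
  rw [← length_profile, profile_word, List.length_ofFn]

theorem word_mem_words (κ : Kappa ℓ k) : word κ ∈ words ℓ k :=
  mem_words_iff.2 ⟨count_red_word κ, count_black_word κ⟩

theorem exists_word_eq {s : List Color} (hs : s ∈ words ℓ k) : ∃ κ : Kappa ℓ k, word κ = s := by
  obtain ⟨hr, hb⟩ := mem_words_iff.1 hs
  have hl : (profile s).length = ℓ := (length_profile s).trans hr
  let κ : Kappa ℓ k :=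
    { toFun := fun h => ⟨(profile s)[(h : ℕ)]'(by omega), by
        have := profile_le s _ (List.getElem_mem (l := profile s) (n := h) (by omega))
        omega⟩
      monotone' := fun a b hab => by
        rcases hab.eq_or_lt with rfl | hlt
        · exact le_rfl
        · exact List.pairwise_iff_getElem.1 (pairwise_profile s) a b (by omega) (by omega) hlt }
  refine ⟨κ, eq_of_profile_eq ?_ ((count_black_word κ).trans hb.symm)⟩
  rw [profile_word]
  refine List.ext_getElem (by simp [hl]) fun n h1 h2 => ?_
  rw [List.getElem_ofFn]
  rfl

theorem mem_words_iff_exists {s : List Color} :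
    s ∈ words ℓ k ↔ ∃ κ : Kappa ℓ k, word κ = s :=
  ⟨exists_word_eq, by rintro ⟨κ, rfl⟩; exact word_mem_words κ⟩

/-- The values of `κ` are read off from the profile of its word. -/
theorem profile_word_getElem? (κ : Kappa ℓ k) (h : Fin ℓ) :
    (profile (word κ))[(h : ℕ)]? = some (κ h : ℕ) := by
  simp [profile_word]

theorem profile_red_black (L R : List Color) :
    profile (L ++ [red, black] ++ R) =
      profile L ++ L.count black :: (profile R).map (· + (L.count black + 1)) := by
  simp [profile_append, profile]
  grind

theorem profile_black_red (L R : List Color) :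
    profile (L ++ [black, red] ++ R) =
      profile L ++ (L.count black + 1) :: (profile R).map (· + (L.count black + 1)) := by
  simp [profile_append, profile]
  grind

/-- Red letters in `L` have at most `L.count black` black letters on their left, those in `R` at
least two more. This is both the condition for `psi` and what makes all ideal generators symmetric
in the two crossing variables. -/
theorem count_black_succ_notMem_profile (L R : List Color) :
    L.count black + 1 ∉ profile (L ++ [black, black] ++ R) := by
  simp only [profile_append, List.mem_append, List.mem_map, profile, List.map_nil,
    List.not_mem_nil, List.count_append]
  rintro ((h | ⟨b, ⟨⟩, -⟩) | ⟨b, -, hb⟩)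
  · have := profile_le L _ h
    omega
  · simp at hb
    omega

theorem exists_apply_eq_of_mem_profile {κ : Kappa ℓ k} {j : ℕ} (h : j ∈ profile (word κ)) :
    ∃ h, (κ h : ℕ) = j := by
  simpa [profile_word] using h

theorem eq_and_eq_of_append_black_eq {A A' B B' : List Color}
    (h : A ++ black :: B = A' ++ black :: B') (hc : A.count black = A'.count black) :
    A = A' ∧ B = B' := by
  induction A generalizing A' with
  | nil =>
    cases A' with
    | nil => simpa using h
    | cons c A' => cases c <;> simp at h hc
  | cons c A ih =>
    cases A' with
    | nil => cases c <;> simp at h hc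
    | cons d A' =>
      obtain ⟨rfl, ht⟩ := List.cons.inj h
      obtain ⟨rfl, rfl⟩ := ih ht (by simpa [List.count_cons] using hc)
      exact ⟨rfl, rfl⟩

/-- The two profiles differ in a single entry, which is `i` in one and `i + 1` in the other. Entries
before it are at most `i` and entries after it at least `i + 1`, so it is the last `i` of `κ` and
the first `i + 1` of `κ'`. -/
theorem eq_plus_and_minus {κ κ' : Kappa ℓ k} {L R : List Color} {i : Fin k}
    (hi : L.count black = i) (h : word κ = L ++ [red, black] ++ R)
    (h' : word κ' = L ++ [black, red] ++ R) : κ' = plus κ i ∧ κ = minus κ' i := by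
  have e1 := profile_word_getElem? κ
  have e2 := profile_word_getElem? κ'
  rw [h, profile_red_black, hi] at e1
  rw [h', profile_black_red, hi] at e2
  have hq : (profile L).length < ℓ := by
    have := count_red_word κ
    rw [h] at this
    rw [length_profile, ← this]
    simp
  have hle := profile_le L
  rw [hi] at hle
  -- The red strand being crossed has as its number the count of red letters in `L`.
  set q : Fin ℓ := ⟨(profile L).length, hq⟩ with hqdef
  have a1 : κ q = i.castSucc := by
    have := e1 q
    simp [q] at this
    exact Fin.ext this.symm
  have a2 : κ' q = i.succ := by
    have := e2 q
    simp [q] at this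
    exact Fin.ext this.symm
  have hlt : ∀ h : Fin ℓ, h < q → κ h = κ' h ∧ κ h ≤ i.castSucc := by
    intro h hh
    have hh' : (h : ℕ) < (profile L).length := hh
    have b1 := e1 h
    have b2 := e2 h
    rw [List.getElem?_append_left hh'] at b1 b2
    exact ⟨Fin.ext (Option.some.inj (b1.symm.trans b2)), hle _ (List.mem_of_getElem? b1)⟩
  have hgt : ∀ h : Fin ℓ, q < h → κ h = κ' h ∧ i.succ ≤ κ h := by
    intro h hh
    have hh' : (profile L).length < (h : ℕ) := hh
    have b1 := e1 h
    have b2 := e2 h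
    obtain ⟨m, hm⟩ : ∃ m, (h : ℕ) - (profile L).length = m + 1 := ⟨_, (Nat.sub_add_cancel (by omega)).symm⟩
    rw [List.getElem?_append_right hh'.le, hm, List.getElem?_cons_succ] at b1 b2
    refine ⟨Fin.ext (Option.some.inj (b1.symm.trans b2)), ?_⟩
    have := List.mem_of_getElem? b1
    simp only [List.mem_map] at this
    obtain ⟨c, -, hc⟩ := this
    rw [Fin.le_def, ← hc]
    simp
  have hne : i.castSucc < i.succ := Fin.castSucc_lt_succ
  constructor <;> refine OrderHom.ext _ _ (funext fun x => ?_)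
  · change κ' x = if κ x = i.castSucc ∧ ∀ h', x < h' → κ h' ≠ i.castSucc then i.succ else κ x
    rcases lt_trichotomy x q with hx | rfl | hx
    · rw [if_neg (fun hc => hc.2 q hx a1), (hlt x hx).1]
    · rw [if_pos ⟨a1, fun y hy => (hne.trans_le (hgt y hy).2).ne'⟩, a2]
    · rw [if_neg (fun hc => (hne.trans_le (hgt x hx).2).ne' hc.1), (hgt x hx).1]
  · change κ x = if κ' x = i.succ ∧ ∀ h', h' < x → κ' h' ≠ i.succ then i.castSucc else κ' x
    rcases lt_trichotomy x q with hx | rfl | hx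
    · rw [if_neg, (hlt x hx).1]
      rw [← (hlt x hx).1]
      exact fun hc => ((hlt x hx).2.trans_lt hne).ne hc.1
    · rw [if_pos, a1]
      refine ⟨a2, fun y hy => ?_⟩
      rw [← (hlt y hy).1]
      exact ((hlt y hy).2.trans_lt hne).ne
    · rw [if_neg (fun hc => hc.2 q hx a2), (hgt x hx).1]

/-! ### Cutting the word of a slice at a black strand -/

theorem pre_append_post (κ : Kappa ℓ k) {i : ℕ} (hi : i < k) :
    pre κ i ++ [black] ++ post κ i = word κ := by
  have : List.range k = List.range i ++ i :: List.range' (i + 1) (k - (i + 1)) := by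
    rw [← List.range'_succ, List.range_eq_range', List.range_eq_range']
    have := List.range'_append_1 (s := 0) (m := i) (n := k - (i + 1) + 1)
    rw [zero_add] at this
    rw [this]
    congr 1
    omega
  simp [word, pre, post, this]

theorem post_eq (κ : Kappa ℓ k) {i : ℕ} (hi : i + 1 < k) :
    post κ i = reds κ (i + 1) ++ [black] ++ post κ (i + 1) := by
  obtain ⟨m, hm⟩ : ∃ m, k - (i + 1) = m + 1 := ⟨_, (Nat.sub_add_cancel (by omega)).symm⟩
  have hm' : k - (i + 1 + 1) = m := by omega
  simp [post, hm, hm', List.range'_succ]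

theorem reds_eq_nil_iff (κ : Kappa ℓ k) (j : ℕ) : reds κ j = [] ↔ ∀ h, (κ h : ℕ) ≠ j := by
  simp [reds, Finset.filter_eq_empty_iff]

theorem reds_eq_cons {κ : Kappa ℓ k} {j : ℕ} (h : ∃ h, (κ h : ℕ) = j) :
    ∃ n, reds κ j = List.replicate (n + 1) red := by
  have : reds κ j ≠ [] := by
    rw [Ne, reds_eq_nil_iff]
    push Not
    exact h
  rw [reds] at this ⊢
  generalize Finset.card _ = m at this ⊢
  cases m with
  | zero => simp at this
  | succ n => exact ⟨n, rfl⟩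

theorem pre_append_post_of_forall_ne (κ : Kappa ℓ k) {i : ℕ} (hi : i + 1 < k)
    (h : ∀ h, (κ h : ℕ) ≠ i + 1) : pre κ i ++ [black, black] ++ post κ (i + 1) = word κ := by
  rw [← pre_append_post κ (Nat.lt_of_succ_lt hi), post_eq κ hi, (reds_eq_nil_iff κ _).2 h]
  simp

theorem dropLast_pre_append_post {κ : Kappa ℓ k} {i : ℕ} (hi : i < k)
    (h : ∃ h, (κ h : ℕ) = i) : (pre κ i).dropLast ++ [red, black] ++ post κ i = word κ := by
  obtain ⟨n, hn⟩ := reds_eq_cons h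
  rw [← pre_append_post κ hi]
  simp only [pre, hn, List.replicate_succ', ← List.append_assoc, List.dropLast_concat]
  simp

theorem pre_append_tail_post {κ : Kappa ℓ k} {i : ℕ} (hi : i < k)
    (h : ∃ h, (κ h : ℕ) = i + 1) : pre κ i ++ [black, red] ++ (post κ i).tail = word κ := by
  obtain ⟨n, hn⟩ := reds_eq_cons h
  rw [← pre_append_post κ hi]
  -- After the last black strand the red letter comes from the final block `reds κ k`.
  rcases (Nat.succ_le_of_lt hi).eq_or_lt with rfl | hlt
  · simp [post, hn, List.replicate_succ]
  · rw [post_eq κ hlt, hn]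
    simp [List.replicate_succ]

end

end Stendhal

namespace Stendhal

noncomputable section

open Color

variable {k : ℕ} {𝕜 : Type*} [Field 𝕜]

open MvPolynomial

/-! ### Complete symmetric polynomials -/

/-- Monomials of degree `n + 1` are split according to whether they contain the extra variable. -/
theorem hsymm_option_succ {σ : Type*} [Fintype σ] [DecidableEq σ] (n : ℕ) :
    hsymm (Option σ) 𝕜 (n + 1) =
      X none * hsymm (Option σ) 𝕜 n + rename some (hsymm σ 𝕜 (n + 1)) := by
  rw [hsymm, ← (symOptionSuccEquiv (α := σ) (n := n)).symm.sum_comp, Fintype.sum_sum_type]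
  congr 1
  · rw [hsymm, Finset.mul_sum]
    refine Finset.sum_congr rfl fun s _ => ?_
    change ((none ::ₘ s.1).map X).prod = _
    rw [Multiset.map_cons, Multiset.prod_cons]
  · rw [hsymm, map_sum]
    refine Finset.sum_congr rfl fun s _ => ?_
    change ((s.map Function.Embedding.some : Sym (Option σ) (n + 1)).1.map X).prod = _
    rw [map_multiset_prod, Multiset.map_map]
    change ((Multiset.map _ s.1).map X).prod = _
    rw [Multiset.map_map]
    simp [Function.comp_def]

theorem hFirst_zero_right (j : ℕ) : hFirst 𝕜 k j 0 = 1 := by simp [hFirst]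

/-- The variables with index below `j + 1`, as those with index below `j` together with one more. -/
def ltSuccEquiv {j : ℕ} (hj : j < k) :
    Option {i : Fin k // (i : ℕ) < j} ≃ {i : Fin k // (i : ℕ) < j + 1} where
  toFun o := o.elim ⟨⟨j, hj⟩, Nat.lt_succ_self j⟩ fun i => ⟨i.1, Nat.lt_succ_of_lt i.2⟩
  invFun i := if h : (i.1 : ℕ) < j then some ⟨i.1, h⟩ else none
  left_inv o := by
    cases o with
    | none => simp
    | some i => simp [i.2]
  right_inv i := by
    by_cases h : (i.1 : ℕ) < j
    · simp [h]
    · have := i.2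
      simp only [h, dite_false, Option.elim_none]
      exact Subtype.ext (Fin.ext (by simp; omega))

theorem hFirst_succ_succ {j : ℕ} (hj : j < k) (p : ℕ) :
    hFirst 𝕜 k (j + 1) (p + 1) =
      X ⟨j, hj⟩ * hFirst 𝕜 k (j + 1) p + hFirst 𝕜 k j (p + 1) := by
  simp only [hFirst]
  rw [← rename_hsymm _ _ _ (ltSuccEquiv hj), ← rename_hsymm _ _ p (ltSuccEquiv hj),
    hsymm_option_succ]
  simp only [map_add, map_mul, rename_rename, rename_X]
  rfl

/-- When both or neither of the two variables occur, the swap only permutes the variables of a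
symmetric polynomial. -/
theorem rename_swap_hFirst {a b : Fin k} {j : ℕ} (h : (a : ℕ) < j ↔ (b : ℕ) < j) (p : ℕ) :
    rename (Equiv.swap a b) (hFirst 𝕜 k j p) = hFirst 𝕜 k j p := by
  have hs : ∀ i : Fin k, (i : ℕ) < j ↔ ((Equiv.swap a b i : Fin k) : ℕ) < j := by
    intro i
    rcases eq_or_ne i a with rfl | hi
    · simpa using h
    · rcases eq_or_ne i b with rfl | hi'
      · simpa using h.symm
      · rw [Equiv.swap_apply_of_ne_of_ne hi hi']
  let σ : Equiv.Perm {i : Fin k // (i : ℕ) < j} := (Equiv.swap a b).subtypePerm fun i => (hs i).symm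
  rw [hFirst]
  conv_rhs => rw [← rename_hsymm _ _ p σ]
  rw [rename_rename, rename_rename]
  rfl

/-! ### Demazure operators -/

theorem X_sub_X_ne_zero {i j : Fin k} (h : i ≠ j) :
    (X j - X i : MvPolynomial (Fin k) 𝕜) ≠ 0 :=
  sub_ne_zero.2 fun e => h (X_injective e).symm

/-- The polynomial ring is a domain, so the quotient is unique for `i ≠ j`. Identities for Demazure
operators can thus be proved by clearing denominators. -/
theorem demazure_eq_iff {i j : Fin k} (h : i ≠ j) {f g : MvPolynomial (Fin k) 𝕜} :
    demazure i j f = g ↔ (X j - X i) * g = f - rename (Equiv.swap i j) f := by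
  rw [← sub_mul_demazure]
  exact ⟨fun e => by rw [e], fun e => (mul_left_cancel₀ (X_sub_X_ne_zero h) e).symm⟩

theorem demazure_add {i j : Fin k} (h : i ≠ j) (f g : MvPolynomial (Fin k) 𝕜) :
    demazure i j (f + g) = demazure i j f + demazure i j g := by
  rw [demazure_eq_iff h, mul_add, sub_mul_demazure, sub_mul_demazure, map_add]
  ring

theorem demazure_mul {i j : Fin k} (h : i ≠ j) {g : MvPolynomial (Fin k) 𝕜}
    (hg : rename (Equiv.swap i j) g = g) (f : MvPolynomial (Fin k) 𝕜) :
    demazure i j (g * f) = g * demazure i j f := by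
  rw [demazure_eq_iff h, map_mul, hg]
  linear_combination g * sub_mul_demazure i j f

theorem demazure_X_right_mul {i j : Fin k} (h : i ≠ j) (f : MvPolynomial (Fin k) 𝕜) :
    demazure i j (X j * f) = X i * demazure i j f + f := by
  rw [demazure_eq_iff h, map_mul, rename_X, Equiv.swap_apply_right]
  linear_combination X i * sub_mul_demazure i j f

theorem demazure_X_left_mul {i j : Fin k} (h : i ≠ j) (f : MvPolynomial (Fin k) 𝕜) :
    demazure i j (X i * f) = X j * demazure i j f - f := by
  rw [demazure_eq_iff h, map_mul, rename_X, Equiv.swap_apply_left]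
  linear_combination X j * sub_mul_demazure i j f

theorem rename_swap_rename_swap (i j : Fin k) (f : MvPolynomial (Fin k) 𝕜) :
    rename (Equiv.swap i j) (rename (Equiv.swap i j) f) = f := by
  rw [rename_rename]
  convert rename_id_apply f
  funext x
  simp

theorem demazure_demazure {i j : Fin k} (h : i ≠ j) (f : MvPolynomial (Fin k) 𝕜) :
    demazure i j (demazure i j f) = 0 := by
  -- Swapping negates both numerator and denominator, so the quotient is invariant and is killed by
  -- a second application.
  have e := congrArg (rename (Equiv.swap i j)) (sub_mul_demazure i j f)
  simp only [map_mul, map_sub, rename_X, Equiv.swap_apply_left, Equiv.swap_apply_right,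
    rename_swap_rename_swap] at e
  rw [demazure_eq_iff h, mul_zero, eq_comm]
  refine (mul_eq_zero.1 ?_).resolve_left (X_sub_X_ne_zero (𝕜 := 𝕜) h)
  linear_combination sub_mul_demazure i j f + e

theorem demazure_comm {i j a b : Fin k} (hij : i ≠ j) (hab : a ≠ b) (hia : i ≠ a) (hib : i ≠ b)
    (hja : j ≠ a) (hjb : j ≠ b) (f : MvPolynomial (Fin k) 𝕜) :
    demazure i j (demazure a b f) = demazure a b (demazure i j f) := by
  have e := congrArg (rename (Equiv.swap i j)) (sub_mul_demazure a b f)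
  have e' := congrArg (rename (Equiv.swap a b)) (sub_mul_demazure i j f)
  have hc : rename (Equiv.swap i j) (rename (Equiv.swap a b) f) =
      rename (Equiv.swap a b) (rename (Equiv.swap i j) f) := by
    rw [rename_rename, rename_rename]
    congr 2
    have : Equiv.swap i j * Equiv.swap a b = Equiv.swap a b * Equiv.swap i j := by
      refine (Equiv.Perm.disjoint_swap_swap ?_).commute
      simp [hij, hab, hia, hib, hja, hjb]
    exact congrArg DFunLike.coe this
  simp only [map_mul, map_sub, rename_X, Equiv.swap_apply_of_ne_of_ne hia.symm hja.symm,
    Equiv.swap_apply_of_ne_of_ne hib.symm hjb.symm, hc] at e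
  simp only [map_mul, map_sub, rename_X, Equiv.swap_apply_of_ne_of_ne hia hib,
    Equiv.swap_apply_of_ne_of_ne hja hjb] at e'
  apply mul_left_cancel₀ (X_sub_X_ne_zero (𝕜 := 𝕜) hij)
  apply mul_left_cancel₀ (X_sub_X_ne_zero (𝕜 := 𝕜) hab)
  linear_combination (X b - X a) * sub_mul_demazure i j (demazure a b f)
    - (X j - X i) * sub_mul_demazure a b (demazure i j f)
    + sub_mul_demazure a b f - sub_mul_demazure i j f - e + e'

/-- Multiplied by the Vandermonde product, both sides become the alternating sum of `f` over the
symmetric group on `a`, `b`, `c`. -/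
theorem demazure_braid {a b c : Fin k} (hab : a ≠ b) (hac : a ≠ c) (hbc : b ≠ c)
    (f : MvPolynomial (Fin k) 𝕜) :
    demazure a b (demazure b c (demazure a b f)) =
      demazure b c (demazure a b (demazure b c f)) := by
  set s : MvPolynomial (Fin k) 𝕜 →ₐ[𝕜] MvPolynomial (Fin k) 𝕜 := rename (Equiv.swap a b) with hs
  set t : MvPolynomial (Fin k) 𝕜 →ₐ[𝕜] MvPolynomial (Fin k) 𝕜 := rename (Equiv.swap b c) with ht
  have sa : s (X a) = X b := by simp [hs]
  have sb : s (X b) = X a := by simp [hs]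
  have sc : s (X c) = X c := by simp [hs, Equiv.swap_apply_of_ne_of_ne hac.symm hbc.symm]
  have ta : t (X a) = X a := by simp [ht, Equiv.swap_apply_of_ne_of_ne hab hac]
  have tb : t (X b) = X c := by simp [ht]
  have tc : t (X c) = X b := by simp [ht]
  have ss : ∀ g, s (s g) = g := rename_swap_rename_swap a b
  have tt : ∀ g, t (t g) = g := rename_swap_rename_swap b c
  have sts : s (t (s f)) = t (s (t f)) := by
    simp only [hs, ht, rename_rename]
    congr 2
    have : Equiv.swap a b * Equiv.swap b c * Equiv.swap a b =
        Equiv.swap b c * Equiv.swap a b * Equiv.swap b c := by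
      rw [Equiv.swap_mul_swap_mul_swap hab hac, Equiv.swap_comm a b, Equiv.swap_comm b c,
        Equiv.swap_mul_swap_mul_swap hbc.symm hac.symm, Equiv.swap_comm]
    exact congrArg DFunLike.coe this
  have S : ∀ g, (X b - X a) * demazure a b g = g - s g := sub_mul_demazure a b
  have T : ∀ g, (X c - X b) * demazure b c g = g - t g := sub_mul_demazure b c
  -- The factor `X c - X a` appears because `t` carries the inner denominator `X b - X a` to it.
  have st : ∀ g, (X b - X a) * (X c - X a) * (X c - X b) * demazure b c (demazure a b g) =
      (X c - X a) * (g - s g) - (X b - X a) * (t g - t (s g)) := by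
    intro g
    have e := congrArg t (S g)
    simp only [map_mul, map_sub, ta, tb] at e
    linear_combination (X b - X a) * (X c - X a) * T (demazure a b g) + (X c - X a) * S g
      - (X b - X a) * e
  have ts : ∀ g, (X b - X a) * (X c - X a) * (X c - X b) * demazure a b (demazure b c g) =
      (X c - X a) * (g - t g) - (X c - X b) * (s g - s (t g)) := by
    intro g
    have e := congrArg s (T g)
    simp only [map_mul, map_sub, sc, sb] at e
    linear_combination (X c - X b) * (X c - X a) * S (demazure b c g) + (X c - X a) * T g
      - (X c - X b) * e
  have h1 := congrArg s (st f)
  have h2 := congrArg t (ts f)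
  simp only [map_mul, map_sub, sa, sb, sc, ss, sts] at h1
  simp only [map_mul, map_sub, ta, tb, tc, tt] at h2
  have nab := X_sub_X_ne_zero (𝕜 := 𝕜) hab
  have nac := X_sub_X_ne_zero (𝕜 := 𝕜) hac
  have nbc := X_sub_X_ne_zero (𝕜 := 𝕜) hbc
  have l1 : (X b - X a) * (X c - X a) * (X c - X b) *
      demazure a b (demazure b c (demazure a b f)) =
      f - s f - t f + t (s f) + s (t f) - t (s (t f)) := by
    apply mul_left_cancel₀ nab
    linear_combination (X b - X a) * (X c - X a) * (X c - X b) * S (demazure b c (demazure a b f))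
      + st f + h1
  have l2 : (X b - X a) * (X c - X a) * (X c - X b) *
      demazure b c (demazure a b (demazure b c f)) =
      f - s f - t f + t (s f) + s (t f) - t (s (t f)) := by
    apply mul_left_cancel₀ nbc
    linear_combination (X b - X a) * (X c - X a) * (X c - X b) * T (demazure a b (demazure b c f))
      + ts f + h2
  exact mul_left_cancel₀ (mul_ne_zero (mul_ne_zero nab nac) nbc) (l1.trans l2.symm)

end

end Stendhal

namespace Stendhal

noncomputable section

open Color MvPolynomial

variable {𝕜 : Type*} [Field 𝕜] {ℓ k : ℕ}

/-! ### The ideals in terms of profiles -/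

variable (𝕜 k) in
/-- The ideal generated by the `h_p` in the first `b` variables for `p > a - b`, where `b` is the
entry number `a` of the list. -/
def profileIdeal (l : List ℕ) : Ideal (MvPolynomial (Fin k) 𝕜) :=
  Ideal.span {f | ∃ a b p : ℕ, l[a]? = some b ∧ (a : ℤ) - b < p ∧ f = hFirst 𝕜 k b p}

theorem hFirst_mem_profileIdeal {l : List ℕ} {a b p : ℕ} (h : l[a]? = some b)
    (hp : (a : ℤ) - b < p) : hFirst 𝕜 k b p ∈ profileIdeal 𝕜 k l :=
  Ideal.subset_span ⟨a, b, p, h, hp, rfl⟩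

/-- The appended red letter has position `ℓ`, counted from 0, and entry `k`, so its bound `ℓ - k` is
that of the additional generators. -/
theorem I_eq_profileIdeal (κ : Kappa ℓ k) :
    I 𝕜 κ = profileIdeal 𝕜 k (profile (word κ ++ [red])) := by
  have hw : profile (word κ ++ [red]) = (List.ofFn fun h => (κ h : ℕ)) ++ [k] := by
    simp [profile_append, profile_word, count_black_word, profile]
  rw [hw]
  apply le_antisymm
  · refine Ideal.span_le.2 ?_
    rintro f (⟨q, p, hq, rfl⟩ | ⟨p, hq, rfl⟩)
    · refine hFirst_mem_profileIdeal (a := q) ?_ (by omega)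
      rw [List.getElem?_append_left (by simp)]
      simp
    · exact hFirst_mem_profileIdeal (a := ℓ) (by simp) hq
  · refine Ideal.span_le.2 ?_
    rintro f ⟨a, b, p, hab, hp, rfl⟩
    apply Ideal.subset_span
    rcases lt_or_ge a ℓ with ha | ha
    · rw [List.getElem?_append_left (by simpa using ha)] at hab
      simp only [List.getElem?_ofFn, ha, dite_true, Option.some.injEq] at hab
      subst hab
      exact Or.inl ⟨⟨a, ha⟩, p, by simp only; omega, rfl⟩
    · rw [List.getElem?_append_right (by simpa using ha), List.getElem?_singleton] at hab
      simp only [List.length_ofFn, Option.ite_none_right_eq_some, Option.some.injEq] at hab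
      obtain ⟨h0, rfl⟩ := hab
      obtain rfl : a = ℓ := by omega
      exact Or.inr ⟨p, hp, rfl⟩

/-- Dropping one variable raises the degree bound by one, which is exactly what the recursion
`hFirst_succ_succ` needs. -/
theorem hFirst_mem_of_le {J : Ideal (MvPolynomial (Fin k) 𝕜)} {c : ℤ} {b b' : ℕ} (hb : b ≤ k)
    (hle : b' ≤ b) (h : ∀ p : ℕ, c - b < p → hFirst 𝕜 k b p ∈ J) (p : ℕ) (hp : c - b' < p) :
    hFirst 𝕜 k b' p ∈ J := by
  induction b with
  | zero =>
    obtain rfl : b' = 0 := by omega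
    exact h p hp
  | succ b ih =>
    rcases hle.eq_or_lt with rfl | hlt
    · exact h p hp
    · refine ih (by omega) (by omega) fun q hq => ?_
      cases q with
      -- In degree 0 the recursion is unavailable, but both polynomials are 1.
      | zero =>
        have := h 0 (by push_cast at hq ⊢; omega)
        rwa [hFirst_zero_right] at this ⊢
      | succ q =>
        have e := hFirst_succ_succ (𝕜 := 𝕜) (Nat.lt_of_succ_le hb) q
        rw [← sub_eq_iff_eq_add'] at e
        rw [← e]
        exact J.sub_mem (h _ (by push_cast at hq ⊢; omega))
          (J.mul_mem_left _ (h _ (by push_cast at hq ⊢; omega)))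

theorem profileIdeal_le {P Q : List ℕ} {i : ℕ} (hi : i < k) :
    profileIdeal 𝕜 k (P ++ i :: Q) ≤ profileIdeal 𝕜 k (P ++ (i + 1) :: Q) := by
  refine Ideal.span_le.2 ?_
  rintro f ⟨a, b, p, hab, hp, rfl⟩
  rcases lt_trichotomy a P.length with ha | rfl | ha
  · refine hFirst_mem_profileIdeal (a := a) ?_ hp
    rwa [List.getElem?_append_left ha] at hab ⊢
  · obtain rfl : i = b := by simpa using hab
    refine hFirst_mem_of_le (c := P.length) (b := i + 1) hi (by omega) (fun q hq => ?_) p hp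
    exact hFirst_mem_profileIdeal (a := P.length) (by simp) hq
  · refine hFirst_mem_profileIdeal (a := a) ?_ hp
    obtain ⟨m, hm⟩ : ∃ m, a - P.length = m + 1 := ⟨_, (Nat.sub_add_cancel (by omega)).symm⟩
    rw [List.getElem?_append_right ha.le, hm, List.getElem?_cons_succ] at hab ⊢
    exact hab

/-- Only the generators of the changed entry matter. The recursion writes their multiple by the
variable as a difference of two complete symmetric polynomials of degree `p + 1`: the one in `i`
variables belongs to the new entry, the one in `i + 1` variables descends from the next entry `b`.
-/
theorem X_mul_mem_profileIdeal {P Q : List ℕ} {i b : ℕ} (hi : i < k) (hb : i + 1 ≤ b)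
    (hbk : b ≤ k) {f : MvPolynomial (Fin k) 𝕜}
    (hf : f ∈ profileIdeal 𝕜 k (P ++ (i + 1) :: b :: Q)) :
    X ⟨i, hi⟩ * f ∈ profileIdeal 𝕜 k (P ++ i :: b :: Q) := by
  suffices h : profileIdeal 𝕜 k (P ++ (i + 1) :: b :: Q) ≤
      Submodule.comap (LinearMap.mulLeft (MvPolynomial (Fin k) 𝕜) (X ⟨i, hi⟩))
        (profileIdeal 𝕜 k (P ++ i :: b :: Q)) from h hf
  refine Submodule.span_le.2 ?_
  rintro f ⟨a, b', p, hab, hp, rfl⟩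
  change X ⟨i, hi⟩ * hFirst 𝕜 k b' p ∈ profileIdeal 𝕜 k (P ++ i :: b :: Q)
  rcases lt_trichotomy a P.length with ha | rfl | ha
  · refine Ideal.mul_mem_left _ _ (hFirst_mem_profileIdeal (a := a) ?_ hp)
    rwa [List.getElem?_append_left ha] at hab ⊢
  · obtain rfl : i + 1 = b' := by simpa using hab
    have e := hFirst_succ_succ (𝕜 := 𝕜) hi p
    rw [← sub_eq_iff_eq_add] at e
    rw [← e]
    refine Ideal.sub_mem _ ?_ ?_
    -- The next entry sits one place later, which the increase of the degree from `p` to `p + 1`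
    -- compensates.
    · refine hFirst_mem_of_le (c := P.length + 1) hbk hb (fun q hq => ?_) (p + 1)
        (by push_cast at hp ⊢; omega)
      exact hFirst_mem_profileIdeal (a := P.length + 1) (by simp) (by push_cast; exact hq)
    · exact hFirst_mem_profileIdeal (a := P.length) (by simp) (by push_cast at hp ⊢; omega)
  · refine Ideal.mul_mem_left _ _ (hFirst_mem_profileIdeal (a := a) ?_ hp)
    obtain ⟨m, hm⟩ : ∃ m, a - P.length = m + 1 := ⟨_, (Nat.sub_add_cancel (by omega)).symm⟩
    rw [List.getElem?_append_right ha.le, hm, List.getElem?_cons_succ] at hab ⊢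
    exact hab

/-- As no entry is `i + 1`, every generator is symmetric in the two variables, and the Demazure
operator is linear over such polynomials. -/
theorem demazure_mem_profileIdeal {l : List ℕ} {i : ℕ} (hi : i + 1 < k) (hl : i + 1 ∉ l)
    {f : MvPolynomial (Fin k) 𝕜} (hf : f ∈ profileIdeal 𝕜 k l) :
    demazure ⟨i, Nat.lt_of_succ_lt hi⟩ ⟨i + 1, hi⟩ f ∈ profileIdeal 𝕜 k l := by
  set a : Fin k := ⟨i, Nat.lt_of_succ_lt hi⟩
  set b : Fin k := ⟨i + 1, hi⟩
  have hab : a ≠ b := by simp [a, b]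
  obtain ⟨n, c, g, rfl⟩ := Submodule.mem_span_set'.1 hf
  have hD : ∀ s : Finset (Fin n), demazure a b (∑ j ∈ s, c j • (g j : MvPolynomial (Fin k) 𝕜)) =
      ∑ j ∈ s, demazure a b (c j • (g j : MvPolynomial (Fin k) 𝕜)) := by
    intro s
    exact map_sum (AddMonoidHom.mk' (demazure a b) (demazure_add hab)) _ s
  rw [hD]
  refine Ideal.sum_mem _ fun j _ => ?_
  obtain ⟨a', b', p, h1, h2, h3⟩ := (g j).2
  have hb' : b' ≠ i + 1 := fun h => hl (h ▸ List.mem_of_getElem? h1)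
  rw [h3, smul_eq_mul, mul_comm, demazure_mul hab]
  · exact Ideal.mul_mem_right _ _ (hFirst_mem_profileIdeal h1 h2)
  · refine rename_swap_hFirst ?_ p
    simp only [a, b]
    omega

/-! ### The operators on polynomials -/

variable (𝕜 k) in
/-- The variable number `i`, or `0` if there is none. -/
def var (i : ℕ) : MvPolynomial (Fin k) 𝕜 := if h : i < k then X ⟨i, h⟩ else 0

theorem var_of_lt {i : ℕ} (h : i < k) : var 𝕜 k i = X ⟨i, h⟩ := dif_pos h

variable (𝕜 k) in
/-- The Demazure operator for the variables number `i` and `i + 1` as a linear map, or `0` if there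
are no such variables. -/
def dem (i : ℕ) : MvPolynomial (Fin k) 𝕜 →ₗ[𝕜] MvPolynomial (Fin k) 𝕜 :=
  if h : i + 1 < k then
    { toFun := demazure ⟨i, Nat.lt_of_succ_lt h⟩ ⟨i + 1, h⟩
      map_add' := demazure_add (by simp)
      map_smul' := fun c f => by
        rw [smul_eq_C_mul, demazure_mul (by simp) (rename_C _ _), ← smul_eq_C_mul,
          RingHom.id_apply] }
  else 0

theorem dem_apply {i : ℕ} (h : i + 1 < k) (f : MvPolynomial (Fin k) 𝕜) :
    dem 𝕜 k i f = demazure ⟨i, Nat.lt_of_succ_lt h⟩ ⟨i + 1, h⟩ f := by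
  rw [dem, dif_pos h]
  rfl

theorem dem_of_not {i : ℕ} (h : ¬ i + 1 < k) : dem 𝕜 k i = 0 := dif_neg h

variable (𝕜 k) in
/-- The operator by which a piece with `i` black strands on its left acts on polynomials. -/
def polyOp (i : ℕ) : Piece → MvPolynomial (Fin k) 𝕜 →ₗ[𝕜] MvPolynomial (Fin k) 𝕜
  | .dot => LinearMap.mulLeft 𝕜 (var 𝕜 k i)
  | .bb => dem 𝕜 k i
  | .rb => LinearMap.id
  | .br => LinearMap.mulLeft 𝕜 (var 𝕜 k i)

theorem var_mul_dem_comm {i j : ℕ} (h : i < j ∨ j + 1 < i) (f : MvPolynomial (Fin k) 𝕜) :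
    dem 𝕜 k j (var 𝕜 k i * f) = var 𝕜 k i * dem 𝕜 k j f := by
  by_cases hj : j + 1 < k
  · by_cases hi : i < k
    · rw [dem_apply hj, dem_apply hj, var_of_lt hi, demazure_mul (by simp)]
      rw [rename_X, Equiv.swap_apply_of_ne_of_ne] <;> simp <;> omega
    · simp [var, hi]
  · simp [dem_of_not hj]

theorem dem_comm {i j : ℕ} (h : i + 1 < j) (f : MvPolynomial (Fin k) 𝕜) :
    dem 𝕜 k i (dem 𝕜 k j f) = dem 𝕜 k j (dem 𝕜 k i f) := by
  by_cases hj : j + 1 < k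
  · simp only [dem_apply hj, dem_apply (show i + 1 < k by omega)]
    apply demazure_comm <;> simp <;> omega
  · simp [dem_of_not hj]

/-- The hypothesis makes the variables used by `p` and `q` disjoint. -/
theorem polyOp_comm {i j : ℕ} {p : Piece} (h : i + p.bot.count black ≤ j) (q : Piece)
    (f : MvPolynomial (Fin k) 𝕜) :
    polyOp 𝕜 k i p (polyOp 𝕜 k j q f) = polyOp 𝕜 k j q (polyOp 𝕜 k i p f) := by
  cases p <;> cases q <;> simp [Piece.bot] at h <;>
    simp only [polyOp, LinearMap.mulLeft_apply, LinearMap.id_apply]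
  · exact mul_left_comm _ _ _
  · exact (var_mul_dem_comm (by omega) f).symm
  · exact mul_left_comm _ _ _
  · exact var_mul_dem_comm (by omega) f
  · exact dem_comm (by omega) f
  · exact var_mul_dem_comm (by omega) f
  · exact mul_left_comm _ _ _
  · exact (var_mul_dem_comm (by omega) f).symm
  · exact mul_left_comm _ _ _

theorem count_black_top (p : Piece) : p.top.count black = p.bot.count black := by
  cases p <;> rfl

theorem count_red_top (p : Piece) : p.top.count red = p.bot.count red := by
  cases p <;> rfl

theorem top_mem_words_iff {L R : List Color} {p : Piece} :
    L ++ p.top ++ R ∈ words ℓ k ↔ L ++ p.bot ++ R ∈ words ℓ k := by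
  simp only [mem_words_iff, List.count_append, count_black_top, count_red_top]

theorem polyOp_mem {L R : List Color} {p : Piece} (h : L ++ p.bot ++ R ∈ words ℓ k)
    {f : MvPolynomial (Fin k) 𝕜}
    (hf : f ∈ profileIdeal 𝕜 k (profile (L ++ p.bot ++ R ++ [red]))) :
    polyOp 𝕜 k (L.count black) p f ∈ profileIdeal 𝕜 k (profile (L ++ p.top ++ R ++ [red])) := by
  have hk := (mem_words_iff.1 h).2
  rw [List.append_assoc _ R] at hf ⊢
  cases p <;> simp only [Piece.bot, Piece.top, List.count_append] at hf hk ⊢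
  · exact Ideal.mul_mem_left _ _ hf
  · have hi : L.count black + 1 < k := by simp at hk; omega
    rw [polyOp, dem_apply hi]
    exact demazure_mem_profileIdeal hi (count_black_succ_notMem_profile _ _) hf
  · rw [profile_red_black] at hf
    rw [profile_black_red]
    exact profileIdeal_le (by simp at hk; omega) hf
  · rw [profile_black_red] at hf
    rw [profile_red_black]
    have hi : L.count black < k := by simp at hk; omega
    rw [polyOp, LinearMap.mulLeft_apply, var_of_lt hi]
    have hle := profile_le (R ++ [red])
    simp at hk
    -- The appended red letter guarantees a next entry, even if the crossed red strand is the last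
    -- one.
    cases hR : profile (R ++ [red]) with
    | nil =>
      have := length_profile (R ++ [red])
      simp [hR] at this
    | cons b Q =>
      rw [hR, List.map_cons] at hf
      rw [hR] at hle
      have := hle b (by simp)
      simp at this
      exact X_mul_mem_profileIdeal hi (by simp) (by simp only; omega) hf

end

end Stendhal

namespace Stendhal

noncomputable section

open Color MvPolynomial

variable {𝕜 : Type*} [Field 𝕜] {ℓ k : ℕ}

/-! ### The action on the representation space -/

variable (𝕜) in
/-- The map `f ↦ cls κ f` as a linear map. -/
def clsHom (κ : Kappa ℓ k) : MvPolynomial (Fin k) 𝕜 →ₗ[𝕜] V 𝕜 ℓ k :=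
  DirectSum.lof 𝕜 (Kappa ℓ k) (fun κ => MvPolynomial (Fin k) 𝕜 ⧸ I 𝕜 κ) κ ∘ₗ
    (Ideal.Quotient.mkₐ 𝕜 (I 𝕜 κ)).toLinearMap

theorem clsHom_apply (κ : Kappa ℓ k) (f : MvPolynomial (Fin k) 𝕜) :
    clsHom 𝕜 κ f = cls 𝕜 κ f := rfl

theorem cls_eq_zero_iff {κ : Kappa ℓ k} {f : MvPolynomial (Fin k) 𝕜} :
    cls 𝕜 κ f = 0 ↔ f ∈ I 𝕜 κ := by
  rw [cls, ← Ideal.Quotient.eq_zero_iff_mem]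
  refine ⟨fun h => ?_, fun h => by rw [h, map_zero]⟩
  exact DirectSum.of_injective (β := fun κ : Kappa ℓ k => MvPolynomial (Fin k) 𝕜 ⧸ I 𝕜 κ) κ
    (h.trans (map_zero _).symm)

theorem proj_cls (κ κ' : Kappa ℓ k) (f : MvPolynomial (Fin k) 𝕜) :
    proj 𝕜 κ (cls 𝕜 κ' f) = if κ' = κ then cls 𝕜 κ f else 0 := by
  rw [proj, cls, LinearMap.comp_apply]
  split_ifs with h
  · subst h
    rw [DirectSum.component.lof_self]
    rfl
  · rw [DirectSum.component.of, dif_neg h, map_zero]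

theorem End_ext {A B : Module.End 𝕜 (V 𝕜 ℓ k)}
    (h : ∀ κ f, A (cls 𝕜 κ f) = B (cls 𝕜 κ f)) : A = B := by
  refine DirectSum.linearMap_ext 𝕜 fun κ => LinearMap.ext fun x => ?_
  obtain ⟨f, rfl⟩ := Ideal.Quotient.mk_surjective x
  exact h κ f

open Classical in
variable (𝕜 ℓ k) in
/-- The class of a polynomial in the summand belonging to a word; zero if there is none. -/
def emb (s : List Color) : MvPolynomial (Fin k) 𝕜 →ₗ[𝕜] V 𝕜 ℓ k :=
  if h : ∃ κ : Kappa ℓ k, word κ = s then clsHom 𝕜 h.choose else 0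

theorem emb_word (κ : Kappa ℓ k) (f : MvPolynomial (Fin k) 𝕜) :
    emb 𝕜 ℓ k (word κ) f = cls 𝕜 κ f := by
  have h : ∃ κ' : Kappa ℓ k, word κ' = word κ := ⟨κ, rfl⟩
  rw [emb, dif_pos h, word_injective h.choose_spec, clsHom_apply]

theorem emb_of_notMem {s : List Color} (h : s ∉ words ℓ k) : emb 𝕜 ℓ k s = 0 := by
  rw [mem_words_iff_exists] at h
  exact dif_neg h

theorem emb_eq_zero_iff {s : List Color} (h : s ∈ words ℓ k) {f : MvPolynomial (Fin k) 𝕜} :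
    emb 𝕜 ℓ k s f = 0 ↔ f ∈ profileIdeal 𝕜 k (profile (s ++ [red])) := by
  obtain ⟨κ, rfl⟩ := exists_word_eq h
  rw [emb_word, cls_eq_zero_iff, I_eq_profileIdeal]

/-- Every red letter, the appended one included, has a black letter on its left. The first profile
entry is therefore positive, its degree bound is negative, and `h_0 = 1` lies in the ideal. -/
theorem emb_black_cons (s : List Color) (f : MvPolynomial (Fin k) 𝕜) :
    emb 𝕜 ℓ k (black :: s) f = 0 := by
  by_cases h : black :: s ∈ words ℓ k
  · rw [emb_eq_zero_iff h]
    suffices h1 : (1 : MvPolynomial (Fin k) 𝕜) ∈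
        profileIdeal 𝕜 k (profile (black :: s ++ [red])) by
      rw [(Ideal.eq_top_iff_one _).2 h1]
      trivial
    cases hs : profile (s ++ [red]) with
    | nil =>
      have := length_profile (s ++ [red])
      simp [hs] at this
    | cons b Q =>
      rw [← hFirst_zero_right (b + 1)]
      refine hFirst_mem_profileIdeal (a := 0) ?_ (by push_cast; omega)
      simp [profile, hs]
  · rw [emb_of_notMem h]
    rfl

/-- A linear map which vanishes on an ideal, as a map on the quotient. -/
def quotientLift {M : Type*} [AddCommMonoid M] [Module 𝕜 M]
    (J : Ideal (MvPolynomial (Fin k) 𝕜)) (φ : MvPolynomial (Fin k) 𝕜 →ₗ[𝕜] M)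
    (h : ∀ f ∈ J, φ f = 0) : (MvPolynomial (Fin k) 𝕜 ⧸ J) →ₗ[𝕜] M :=
  have key : ∀ f g, Ideal.Quotient.mk J f = Ideal.Quotient.mk J g → φ f = φ g := fun f g e => by
    rw [← sub_add_cancel f g, map_add, h _ (Ideal.Quotient.eq.1 e), zero_add]
  have out := Function.surjInv_eq (Ideal.Quotient.mk_surjective (I := J))
  { toFun := fun x => φ (Function.surjInv Ideal.Quotient.mk_surjective x)
    map_add' := fun x y => by
      rw [← map_add]
      exact key _ _ (by rw [map_add, out, out, out])
    map_smul' := fun c x => by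
      rw [RingHom.id_apply, ← map_smul]
      refine key _ _ ?_
      rw [out]
      exact (congrArg (c • ·) (out x)).symm.trans
        (map_smul (Ideal.Quotient.mkₐ 𝕜 J) c _).symm }

theorem quotientLift_mk {M : Type*} [AddCommMonoid M] [Module 𝕜 M]
    {J : Ideal (MvPolynomial (Fin k) 𝕜)} {φ : MvPolynomial (Fin k) 𝕜 →ₗ[𝕜] M}
    {h : ∀ f ∈ J, φ f = 0} (f : MvPolynomial (Fin k) 𝕜) :
    quotientLift J φ h (Ideal.Quotient.mk J f) = φ f := by
  set g := Function.surjInv Ideal.Quotient.mk_surjective (Ideal.Quotient.mk J f)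
  have e : Ideal.Quotient.mk J g = Ideal.Quotient.mk J f := Function.surjInv_eq _ _
  change φ g = φ f
  rw [← sub_add_cancel g f, map_add, h _ (Ideal.Quotient.eq.1 e), zero_add]

open Classical in
/-- The endomorphism which maps the summand belonging to the word `s` to the one belonging to `t`
by the operator `φ` on representatives, and which is zero on the other summands. -/
def arrow (s t : List Color) (φ : MvPolynomial (Fin k) 𝕜 →ₗ[𝕜] MvPolynomial (Fin k) 𝕜)
    (hφ : ∀ f, emb 𝕜 ℓ k s f = 0 → emb 𝕜 ℓ k t (φ f) = 0) : Module.End 𝕜 (V 𝕜 ℓ k) :=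
  DirectSum.toModule 𝕜 (Kappa ℓ k) (V 𝕜 ℓ k) fun κ =>
    if h : word κ = s then
      quotientLift (I 𝕜 κ) (emb 𝕜 ℓ k t ∘ₗ φ) fun f hf => hφ f (by
        rwa [← h, emb_word, cls_eq_zero_iff])
    else 0

variable {s t : List Color} {φ : MvPolynomial (Fin k) 𝕜 →ₗ[𝕜] MvPolynomial (Fin k) 𝕜}
  (hφ : ∀ f, emb 𝕜 ℓ k s f = 0 → emb 𝕜 ℓ k t (φ f) = 0)

theorem arrow_emb_self (f : MvPolynomial (Fin k) 𝕜) :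
    arrow s t φ hφ (emb 𝕜 ℓ k s f) = emb 𝕜 ℓ k t (φ f) := by
  by_cases h : s ∈ words ℓ k
  · obtain ⟨κ, rfl⟩ := exists_word_eq h
    rw [emb_word, arrow, cls, DirectSum.toModule_lof, dif_pos rfl, quotientLift_mk]
    rfl
  · have h0 : emb 𝕜 ℓ k s f = 0 := by rw [emb_of_notMem h]; rfl
    rw [h0, hφ f h0, map_zero]

theorem arrow_emb_of_ne {u : List Color} (hu : u ≠ s) (f : MvPolynomial (Fin k) 𝕜) :
    arrow s t φ hφ (emb 𝕜 ℓ k u f) = 0 := by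
  by_cases h : u ∈ words ℓ k
  · obtain ⟨κ, rfl⟩ := exists_word_eq h
    rw [emb_word, arrow, cls, DirectSum.toModule_lof, dif_neg hu]
    rfl
  · rw [emb_of_notMem h, LinearMap.zero_apply, map_zero]

theorem emb_polyOp_eq_zero (L : List Color) (p : Piece) (R : List Color)
    (f : MvPolynomial (Fin k) 𝕜) (hf : emb 𝕜 ℓ k (L ++ p.bot ++ R) f = 0) :
    emb 𝕜 ℓ k (L ++ p.top ++ R) (polyOp 𝕜 k (L.count black) p f) = 0 := by
  by_cases h : L ++ p.bot ++ R ∈ words ℓ k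
  · rw [emb_eq_zero_iff h] at hf
    rw [emb_eq_zero_iff (top_mem_words_iff.2 h)]
    exact polyOp_mem h hf
  · rw [emb_of_notMem (mt top_mem_words_iff.1 h)]
    rfl

variable (𝕜 ℓ k) in
/-- The action of diagrams with at most one dot or crossing. -/
def genAct : Gen → Module.End 𝕜 (V 𝕜 ℓ k)
  | .idem s => arrow s s LinearMap.id fun _ h => h
  | .layer L p R => arrow (L ++ p.bot ++ R) (L ++ p.top ++ R) (polyOp 𝕜 k (L.count black) p)
      (emb_polyOp_eq_zero L p R)

theorem genAct_idem_emb (s u : List Color) (f : MvPolynomial (Fin k) 𝕜) :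
    genAct 𝕜 ℓ k (.idem s) (emb 𝕜 ℓ k u f) = if u = s then emb 𝕜 ℓ k u f else 0 := by
  split_ifs with h
  · subst h
    exact arrow_emb_self (fun _ h => h) f
  · exact arrow_emb_of_ne (fun _ h => h) h f

theorem genAct_layer_emb {L R u : List Color} {p : Piece} (hu : u = L ++ p.bot ++ R)
    (f : MvPolynomial (Fin k) 𝕜) :
    genAct 𝕜 ℓ k (.layer L p R) (emb 𝕜 ℓ k u f) =
      emb 𝕜 ℓ k (L ++ p.top ++ R) (polyOp 𝕜 k (L.count black) p f) := by
  subst hu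
  exact arrow_emb_self (emb_polyOp_eq_zero L p R) f

theorem genAct_layer_emb_of_ne {L R u : List Color} {p : Piece} (hu : u ≠ L ++ p.bot ++ R)
    (f : MvPolynomial (Fin k) 𝕜) :
    genAct 𝕜 ℓ k (.layer L p R) (emb 𝕜 ℓ k u f) = 0 :=
  arrow_emb_of_ne (emb_polyOp_eq_zero L p R) hu f

variable (𝕜 ℓ k) in
/-- The action of the free algebra. -/
def freeAct : FreeAlgebra 𝕜 Gen →ₐ[𝕜] Module.End 𝕜 (V 𝕜 ℓ k) :=
  FreeAlgebra.lift 𝕜 (genAct 𝕜 ℓ k)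

theorem freeAct_E (s : List Color) : freeAct 𝕜 ℓ k (E 𝕜 s) = genAct 𝕜 ℓ k (.idem s) :=
  FreeAlgebra.lift_ι_apply _ _

theorem freeAct_lay (L : List Color) (p : Piece) (R : List Color) :
    freeAct 𝕜 ℓ k (lay 𝕜 L p R) = genAct 𝕜 ℓ k (.layer L p R) :=
  FreeAlgebra.lift_ι_apply _ _

theorem freeAct_sub (a b : FreeAlgebra 𝕜 Gen) :
    freeAct 𝕜 ℓ k (a - b) = freeAct 𝕜 ℓ k a + (-1 : 𝕜) • freeAct 𝕜 ℓ k b := by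
  rw [sub_eq_add_neg, ← neg_one_smul 𝕜 b, map_add, map_smul]

theorem freeAct_E_emb (s u : List Color) (f : MvPolynomial (Fin k) 𝕜) :
    freeAct 𝕜 ℓ k (E 𝕜 s) (emb 𝕜 ℓ k u f) = if u = s then emb 𝕜 ℓ k u f else 0 := by
  rw [freeAct_E, genAct_idem_emb]

theorem freeAct_lay_emb (L R u : List Color) (p : Piece) (f : MvPolynomial (Fin k) 𝕜) :
    freeAct 𝕜 ℓ k (lay 𝕜 L p R) (emb 𝕜 ℓ k u f) =
      if u = L ++ p.bot ++ R then
        emb 𝕜 ℓ k (L ++ p.top ++ R) (polyOp 𝕜 k (L.count black) p f) else 0 := by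
  rw [freeAct_lay]
  split_ifs with h
  · exact genAct_layer_emb h f
  · exact genAct_layer_emb_of_ne h f

theorem End_ext_emb {A B : Module.End 𝕜 (V 𝕜 ℓ k)}
    (h : ∀ u ∈ words ℓ k, ∀ f, A (emb 𝕜 ℓ k u f) = B (emb 𝕜 ℓ k u f)) : A = B := by
  refine End_ext fun κ f => ?_
  rw [← emb_word]
  exact h _ (word_mem_words κ) f

/-- For a local relation both sides vanish on a summand whose word is not the common bottom; on that
summand an identity of operators on polynomials remains. -/
theorem freeAct_rel {a b : FreeAlgebra 𝕜 Gen} (h : Rel 𝕜 ℓ k a b) :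
    freeAct 𝕜 ℓ k a = freeAct 𝕜 ℓ k b := by
  refine End_ext_emb fun u hu f => ?_
  have hk := (mem_words_iff.1 hu).2
  induction h with
  | idem_mul_self s =>
    rw [map_mul, Module.End.mul_apply, freeAct_E_emb]
    split_ifs with h
    · rw [freeAct_E_emb, if_pos h]
    · rw [map_zero]
  | idem_mul_ne s t hst =>
    rw [map_mul, Module.End.mul_apply, freeAct_E_emb, map_zero]
    split_ifs with h
    · rw [freeAct_E_emb, if_neg (h.trans_ne hst.symm)]
      rfl
    · rw [map_zero]
      rfl
  | top_mul L p R =>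
    rw [map_mul, Module.End.mul_apply, freeAct_lay_emb]
    split_ifs with h
    · rw [freeAct_E_emb, if_pos rfl]
    · rw [map_zero]
  | mul_bot L p R =>
    rw [map_mul, Module.End.mul_apply, freeAct_E_emb]
    split_ifs with h
    · rfl
    · rw [map_zero, freeAct_lay_emb, if_neg h]
  | idem_other s hs =>
    rw [freeAct_E_emb, if_neg (by rintro rfl; exact hs hu), map_zero]
    rfl
  | idem_sum =>
    simp only [map_sum, LinearMap.sum_apply, freeAct_E_emb, map_one, Module.End.one_apply]
    rw [Finset.sum_ite_eq, if_pos hu]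
  | interchange L M R p q =>
    simp only [map_mul, Module.End.mul_apply, freeAct_lay_emb]
    by_cases h : u = L ++ p.bot ++ M ++ q.bot ++ R
    · rw [if_pos h, if_pos (by rw [h]; simp), freeAct_lay_emb, freeAct_lay_emb, if_pos (by simp),
        if_pos (by simp), polyOp_comm (by simp), List.count_append, List.count_append,
        List.count_append, List.count_append, count_black_top]
      simp
    · rw [if_neg h, if_neg (by simpa using h), map_zero, map_zero]
  | dot_left_top L R =>
    rw [freeAct_sub]
    by_cases h : u = L ++ black :: black :: R
    · subst h
      have hi : L.count black + 1 < k := by simp at hk; omega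
      simp only [map_mul, LinearMap.add_apply, LinearMap.smul_apply, Module.End.mul_apply]
      simp only [freeAct_lay_emb, freeAct_E_emb, polyOp, Piece.bot, Piece.top, List.append_assoc,
        List.cons_append, List.nil_append, if_true, List.count_append, List.count_singleton_self,
        LinearMap.mulLeft_apply,
        var_of_lt hi, var_of_lt (Nat.lt_of_succ_lt hi), dem_apply hi]
      rw [demazure_X_right_mul (by simp), ← map_smul, ← map_add]
      simp
    · simp [freeAct_lay_emb, freeAct_E_emb, Piece.bot, h]
  | dot_left_bot L R =>
    rw [freeAct_sub]
    by_cases h : u = L ++ black :: black :: R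
    · subst h
      have hi : L.count black + 1 < k := by simp at hk; omega
      simp only [map_mul, LinearMap.add_apply, LinearMap.smul_apply, Module.End.mul_apply]
      simp only [freeAct_lay_emb, freeAct_E_emb, polyOp, Piece.bot, Piece.top, List.append_assoc,
        List.cons_append, List.nil_append, if_true, List.count_append, List.count_singleton_self,
        LinearMap.mulLeft_apply,
        var_of_lt hi, var_of_lt (Nat.lt_of_succ_lt hi), dem_apply hi]
      rw [demazure_X_left_mul (by simp), ← map_smul, ← map_add]
      simp [sub_eq_add_neg]
    · simp [freeAct_lay_emb, freeAct_E_emb, Piece.bot, h]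
  | bigon L R =>
    by_cases h : u = L ++ black :: black :: R
    · subst h
      have hi : L.count black + 1 < k := by simp at hk; omega
      simp [freeAct_lay_emb, Piece.bot, Piece.top, polyOp, dem_apply hi, demazure_demazure]
    · simp [freeAct_lay_emb, Piece.bot, h]
  | braid L R =>
    by_cases h : u = L ++ black :: black :: black :: R
    · subst h
      have hi : L.count black + 1 + 1 < k := by simp at hk; omega
      simp [freeAct_lay_emb, Piece.bot, Piece.top, polyOp, dem_apply hi,
        dem_apply (Nat.lt_of_succ_lt hi)]
      rw [demazure_braid] <;> simp; omega
    · simp [freeAct_lay_emb, Piece.bot, h]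
  | red_triple L R =>
    rw [freeAct_sub]
    by_cases h : u = L ++ black :: red :: black :: R
    · subst h
      have hi : L.count black + 1 < k := by simp at hk; omega
      simp only [map_mul, LinearMap.add_apply, LinearMap.smul_apply, Module.End.mul_apply]
      simp only [freeAct_lay_emb, freeAct_E_emb, polyOp, Piece.bot, Piece.top, List.append_assoc,
        List.cons_append, List.nil_append, if_true, List.count_append, List.count_singleton_self,
        LinearMap.mulLeft_apply, LinearMap.id_apply, show [red].count black = 0 from rfl, add_zero,
        var_of_lt hi, var_of_lt (Nat.lt_of_succ_lt hi), dem_apply hi]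
      -- One red crossing on each side acts as the identity, so the relation reduces to moving a
      -- variable through the Demazure operator.
      rw [demazure_X_left_mul (by simp), ← map_smul, ← map_add]
      simp [sub_eq_add_neg]
    · simp [freeAct_lay_emb, freeAct_E_emb, Piece.bot, h]
  | red_pass L R =>
    by_cases h : u = L ++ black :: black :: red :: R
    · subst h
      have hi : L.count black + 1 < k := by simp at hk; omega
      simp [freeAct_lay_emb, Piece.bot, Piece.top, polyOp, var_of_lt hi,
        var_of_lt (Nat.lt_of_succ_lt hi), dem_apply hi]
      -- The two red crossings multiply by a symmetric product, which commutes with the Demazure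
      -- operator.
      have hs : ∀ a b : Fin k, rename (Equiv.swap a b) (X a * X b : MvPolynomial (Fin k) 𝕜) =
          X a * X b := fun a b => by simp [mul_comm]
      rw [← mul_assoc, ← mul_assoc, demazure_mul (by simp) (hs _ _)]
    · simp [freeAct_lay_emb, Piece.bot, h]
  | red_dot L R =>
    by_cases h : u = L ++ black :: red :: R
    · subst h
      simp [freeAct_lay_emb, Piece.bot, Piece.top, polyOp]
    · simp [freeAct_lay_emb, Piece.bot, h]
  | cost_left L R =>
    by_cases h : u = L ++ black :: red :: R
    · subst h
      simp [freeAct_lay_emb, Piece.bot, Piece.top, polyOp]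
    · simp [freeAct_lay_emb, Piece.bot, h]
  | cost_right L R =>
    by_cases h : u = L ++ red :: black :: R
    · subst h
      simp [freeAct_lay_emb, Piece.bot, Piece.top, polyOp]
    · simp [freeAct_lay_emb, Piece.bot, h]
  | violating s =>
    rw [freeAct_E_emb, map_zero, LinearMap.zero_apply]
    split_ifs with h
    · rw [h]
      exact emb_black_cons s f
    · rfl

end

end Stendhal

namespace Stendhal

noncomputable section

open Color MvPolynomial

variable {𝕜 : Type*} [Field 𝕜] {ℓ k : ℕ}

/-! ### Action of the named elements, and uniqueness -/

theorem genAct_layer_dot_cls {κ : Kappa ℓ k} {L R : List Color} {i : Fin k}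
    (h : word κ = L ++ [black] ++ R) (hi : L.count black = i) (f : MvPolynomial (Fin k) 𝕜) :
    genAct 𝕜 ℓ k (.layer L .dot R) (cls 𝕜 κ f) = cls 𝕜 κ (X i * f) := by
  rw [← emb_word, genAct_layer_emb h, hi, polyOp, LinearMap.mulLeft_apply, var_of_lt i.2,
    ← emb_word, h]
  rfl

theorem genAct_layer_bb_cls {κ : Kappa ℓ k} {L R : List Color} {i : ℕ} (hik : i + 1 < k)
    (h : word κ = L ++ [black, black] ++ R) (hi : L.count black = i)
    (f : MvPolynomial (Fin k) 𝕜) :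
    genAct 𝕜 ℓ k (.layer L .bb R) (cls 𝕜 κ f) =
      cls 𝕜 κ (demazure ⟨i, Nat.lt_of_succ_lt hik⟩ ⟨i + 1, hik⟩ f) := by
  rw [← emb_word, genAct_layer_emb h, hi, polyOp, dem_apply hik, ← emb_word, h]
  rfl

theorem genAct_layer_rb_cls {κ : Kappa ℓ k} {L R : List Color} {i : Fin k}
    (h : word κ = L ++ [red, black] ++ R) (hi : L.count black = i)
    (f : MvPolynomial (Fin k) 𝕜) :
    genAct 𝕜 ℓ k (.layer L .rb R) (cls 𝕜 κ f) = cls 𝕜 (plus κ i) f := by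
  have hw : L ++ Piece.rb.bot ++ R ∈ words ℓ k := h ▸ word_mem_words κ
  obtain ⟨κ', h'⟩ := exists_word_eq (top_mem_words_iff.2 hw)
  rw [← emb_word, genAct_layer_emb h, ← h', emb_word, (eq_plus_and_minus hi h h').1]
  rfl

theorem genAct_layer_br_cls {κ : Kappa ℓ k} {L R : List Color} {i : Fin k}
    (h : word κ = L ++ [black, red] ++ R) (hi : L.count black = i)
    (f : MvPolynomial (Fin k) 𝕜) :
    genAct 𝕜 ℓ k (.layer L .br R) (cls 𝕜 κ f) = cls 𝕜 (minus κ i) (X i * f) := by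
  have hw : L ++ Piece.br.bot ++ R ∈ words ℓ k := h ▸ word_mem_words κ
  obtain ⟨κ', h'⟩ := exists_word_eq (top_mem_words_iff.2 hw)
  rw [← emb_word, genAct_layer_emb h, ← h', emb_word, (eq_plus_and_minus hi h' h).2, hi, polyOp,
    LinearMap.mulLeft_apply, var_of_lt i.2]

theorem genAct_idem_word (κ : Kappa ℓ k) : genAct 𝕜 ℓ k (.idem (word κ)) = proj 𝕜 κ := by
  refine End_ext fun κ' f => ?_
  rw [← emb_word, genAct_idem_emb, emb_word, proj_cls]
  by_cases h : κ' = κ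
  · subst h
    simp
  · rw [if_neg h, if_neg (word_injective.ne h)]

theorem genAct_idem_of_notMem {s : List Color} (h : s ∉ words ℓ k) :
    genAct 𝕜 ℓ k (.idem s) = 0 := by
  refine End_ext_emb fun u hu f => ?_
  rw [genAct_idem_emb, if_neg (by rintro rfl; exact h hu)]
  rfl

variable (𝕜 ℓ k) in
/-- The action of the algebra of Stendhal diagrams. -/
def act : T 𝕜 ℓ k →ₐ[𝕜] Module.End 𝕜 (V 𝕜 ℓ k) :=
  RingQuot.liftAlgHom 𝕜 ⟨freeAct 𝕜 ℓ k, fun _ _ h => freeAct_rel h⟩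

theorem act_toT (a : FreeAlgebra 𝕜 Gen) : act 𝕜 ℓ k (toT 𝕜 ℓ k a) = freeAct 𝕜 ℓ k a :=
  RingQuot.liftAlgHom_mkAlgHom_apply _ _ _ _

theorem toT_rel {a b : FreeAlgebra 𝕜 Gen} (h : Rel 𝕜 ℓ k a b) :
    toT 𝕜 ℓ k a = toT 𝕜 ℓ k b :=
  RingQuot.mkAlgHom_rel 𝕜 h

/-- A homomorphism with the prescribed values on idempotents and on the crossings and dots of the
slices `κ` agrees with the action on all generators. -/
theorem apply_toT_eq_genAct (ρ : T 𝕜 ℓ k →ₐ[𝕜] Module.End 𝕜 (V 𝕜 ℓ k))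
    (he : ∀ κ : Kappa ℓ k, ρ (e 𝕜 κ) = proj 𝕜 κ)
    (hy : ∀ (κ : Kappa ℓ k) (i : Fin k) (f : MvPolynomial (Fin k) 𝕜),
      ρ (y 𝕜 i κ) (cls 𝕜 κ f) = cls 𝕜 κ (X i * f))
    (hpsi : ∀ (κ : Kappa ℓ k) (i : ℕ) (hi : i + 1 < k) (f : MvPolynomial (Fin k) 𝕜),
      (∀ h, (κ h : ℕ) ≠ i + 1) → ρ (psi 𝕜 i κ) (cls 𝕜 κ f) =
        cls 𝕜 κ (demazure ⟨i, Nat.lt_of_succ_lt hi⟩ ⟨i + 1, hi⟩ f))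
    (hplus : ∀ (κ : Kappa ℓ k) (i : Fin k) (f : MvPolynomial (Fin k) 𝕜),
      (∃ h, (κ h : ℕ) = i) → ρ (iotaPlus 𝕜 i κ) (cls 𝕜 κ f) = cls 𝕜 (plus κ i) f)
    (hminus : ∀ (κ : Kappa ℓ k) (i : Fin k) (f : MvPolynomial (Fin k) 𝕜),
      (∃ h, (κ h : ℕ) = i + 1) →
        ρ (iotaMinus 𝕜 i κ) (cls 𝕜 κ f) = cls 𝕜 (minus κ i) (X i * f))
    (g : Gen) : ρ (toT 𝕜 ℓ k (FreeAlgebra.ι 𝕜 g)) = genAct 𝕜 ℓ k g := by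
  have hE : ∀ s, ρ (toT 𝕜 ℓ k (E 𝕜 s)) = genAct 𝕜 ℓ k (.idem s) := by
    intro s
    by_cases hs : s ∈ words ℓ k
    · obtain ⟨κ, rfl⟩ := exists_word_eq hs
      rw [genAct_idem_word]
      exact he κ
    · rw [toT_rel (Rel.idem_other s hs), map_zero, map_zero, genAct_idem_of_notMem hs]
  cases g with
  | idem s => exact hE s
  | layer L p R =>
    change ρ (toT 𝕜 ℓ k (lay 𝕜 L p R)) = _
    refine End_ext fun κ f => ?_
    by_cases hw : word κ = L ++ p.bot ++ R
    · have hk := count_black_word κ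
      rw [hw] at hk
      cases p <;> simp only [Piece.bot] at hw hk
      · obtain ⟨i, hi⟩ : ∃ i : Fin k, L.count black = i :=
          ⟨⟨L.count black, by simp at hk; omega⟩, rfl⟩
        have hs := pre_append_post κ i.2
        rw [hw] at hs
        obtain ⟨h1, h2⟩ := eq_and_eq_of_append_black_eq (by simpa using hs)
          ((count_black_pre κ i).trans hi.symm)
        rw [genAct_layer_dot_cls hw hi, ← hy, y, h1, h2]
      · have hi : L.count black + 1 < k := by simp at hk; omega
        have hne : ∀ h, (κ h : ℕ) ≠ L.count black + 1 := fun h e => by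
          refine count_black_succ_notMem_profile L R ?_
          rw [← hw, ← e]
          exact List.mem_of_getElem? (profile_word_getElem? κ h)
        have hs := pre_append_post_of_forall_ne κ hi hne
        rw [hw] at hs
        obtain ⟨h1, h2⟩ := eq_and_eq_of_append_black_eq (by simpa using hs)
          (count_black_pre κ _)
        rw [genAct_layer_bb_cls hi hw rfl, ← hpsi κ _ hi f hne, psi, h1, List.cons.inj h2 |>.2]
      · obtain ⟨i, hi⟩ : ∃ i : Fin k, L.count black = i :=
          ⟨⟨L.count black, by simp at hk; omega⟩, rfl⟩
        have hex : ∃ h, (κ h : ℕ) = i := exists_apply_eq_of_mem_profile (by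
          rw [hw, profile_red_black, hi]
          simp)
        have hs := pre_append_post κ i.2
        rw [hw] at hs
        -- Cutting at the black strand leaves the crossed red letter at the end of the left part,
        -- whence `dropLast` in `iotaPlus`.
        obtain ⟨h1, h2⟩ := eq_and_eq_of_append_black_eq (A' := L ++ [red]) (B' := R)
          (by simpa using hs) (by simp [count_black_pre, hi])
        rw [genAct_layer_rb_cls hw hi, ← hplus κ i f hex, iotaPlus, h1, h2, List.dropLast_concat]
      · obtain ⟨i, hi⟩ : ∃ i : Fin k, L.count black = i :=
          ⟨⟨L.count black, by simp at hk; omega⟩, rfl⟩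
        have hex : ∃ h, (κ h : ℕ) = i + 1 := exists_apply_eq_of_mem_profile (by
          rw [hw, profile_black_red, hi]
          simp)
        have hs := pre_append_post κ i.2
        rw [hw] at hs
        obtain ⟨h1, h2⟩ := eq_and_eq_of_append_black_eq (by simpa using hs)
          ((count_black_pre κ i).trans hi.symm)
        rw [genAct_layer_br_cls hw hi, ← hminus κ i f hex, iotaMinus, h1, h2, List.tail_cons]
    -- The diagram absorbs the idempotent at its bottom, and this idempotent kills the summand.
    · rw [← toT_rel (Rel.mul_bot L p R), map_mul, map_mul, Module.End.mul_apply, hE, ← emb_word,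
        genAct_idem_emb, if_neg hw, map_zero, genAct_layer_emb_of_ne hw]

end

end Stendhal

open Stendhal in
theorem mainTheorem11 (𝕜 : Type*) [Field 𝕜] (ℓ k : ℕ) :
    ∃! ρ : Stendhal.T 𝕜 ℓ k →ₐ[𝕜] Module.End 𝕜 (Stendhal.V 𝕜 ℓ k),
      (∀ κ : Stendhal.Kappa ℓ k, ρ (Stendhal.e 𝕜 κ) = Stendhal.proj 𝕜 κ) ∧
      (∀ (κ : Stendhal.Kappa ℓ k) (i : Fin k) (f : MvPolynomial (Fin k) 𝕜),
        ρ (Stendhal.y 𝕜 i κ) (Stendhal.cls 𝕜 κ f) =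
          Stendhal.cls 𝕜 κ (MvPolynomial.X i * f)) ∧
      (∀ (κ : Stendhal.Kappa ℓ k) (i : ℕ) (hi : i + 1 < k) (f : MvPolynomial (Fin k) 𝕜),
        (∀ h, (κ h : ℕ) ≠ i + 1) →
        ρ (Stendhal.psi 𝕜 i κ) (Stendhal.cls 𝕜 κ f) =
          Stendhal.cls 𝕜 κ (Stendhal.demazure ⟨i, Nat.lt_of_succ_lt hi⟩ ⟨i + 1, hi⟩ f)) ∧
      (∀ (κ : Stendhal.Kappa ℓ k) (i : Fin k) (f : MvPolynomial (Fin k) 𝕜),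
        (∃ h, (κ h : ℕ) = i) →
        ρ (Stendhal.iotaPlus 𝕜 i κ) (Stendhal.cls 𝕜 κ f) =
          Stendhal.cls 𝕜 (Stendhal.plus κ i) f) ∧
      (∀ (κ : Stendhal.Kappa ℓ k) (i : Fin k) (f : MvPolynomial (Fin k) 𝕜),
        (∃ h, (κ h : ℕ) = i + 1) →
        ρ (Stendhal.iotaMinus 𝕜 i κ) (Stendhal.cls 𝕜 κ f) =
          Stendhal.cls 𝕜 (Stendhal.minus κ i) (MvPolynomial.X i * f)) := by
  refine ⟨act 𝕜 ℓ k, ⟨fun κ => ?_, fun κ i f => ?_, fun κ i hi f h => ?_, fun κ i f h => ?_,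
    fun κ i f h => ?_⟩, ?_⟩
  · rw [e, act_toT, freeAct_E, genAct_idem_word]
  · rw [y, act_toT, freeAct_lay]
    exact genAct_layer_dot_cls (pre_append_post κ i.2).symm (count_black_pre κ i) f
  · rw [psi, act_toT, freeAct_lay]
    exact genAct_layer_bb_cls hi (pre_append_post_of_forall_ne κ hi h).symm (count_black_pre κ i) f
  · rw [iotaPlus, act_toT, freeAct_lay]
    have hw := dropLast_pre_append_post i.2 h
    refine genAct_layer_rb_cls hw.symm ?_ f
    have hc := congrArg (List.count Color.black) (hw.trans (pre_append_post κ i.2).symm)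
    simp only [List.count_append, count_black_pre] at hc
    simp at hc
    omega
  · rw [iotaMinus, act_toT, freeAct_lay]
    exact genAct_layer_br_cls (pre_append_tail_post i.2 h).symm (count_black_pre κ i) f
  · rintro ρ ⟨he, hy, hpsi, hplus, hminus⟩
    -- Homomorphisms out of the quotient are determined by their values on the generators of the
    -- free algebra.
    refine RingQuot.ringQuot_ext' 𝕜 _ _ (FreeAlgebra.hom_ext (funext fun g => ?_))
    have h1 := apply_toT_eq_genAct ρ he hy hpsi hplus hminus g
    have h2 : act 𝕜 ℓ k (toT 𝕜 ℓ k (FreeAlgebra.ι 𝕜 g)) = genAct 𝕜 ℓ k g := by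
      rw [act_toT]
      exact FreeAlgebra.lift_ι_apply _ _
    exact h1.trans h2.symm
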